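/- Let $n\in\mathbb{N}$, $L,B\in\mathbb{R}^{n\times n}$, $X_0\in\mathbb{R}^n$ (deterministic), let $W_t$ be a standard $n$-dimensional Wiener process and let $X_t$ be the solution of $dX_t = L X_t\,dt + B\,dW_t$ with initial value $X_0$. Put $\lambda_k=(k-\tfrac12)\pi$ and $$\varphi^{\cos}_{k,t}(L)=\int_0^t e^{(t-s)L}\cos(\lambda_k s)\,ds ,\qquad k\ge 1 ,$$ let $Z_1,Z_2,\dots$ be independent standard normal random vectors in $\mathbb{R}^n$ (all components independent and $\mathcal N(0,1)$-distributed), and let $$X_t^m = e^{tL}X_0+\sqrt2\sum_{k=1}^m\varphi^{\cos}_{k,t}(L)\,B\,Z_k .$$ Let $\|\cdot\|$ denote the Euclidean vector norm and the spectral matrix norm, and $\|\cdot\|_F$ the Frobenius norm. Then for all $t\in[0,1]$ and all integers $m\ge0$ the vectors $X_t$ and $X_t^m$ are square-integrable, the series below converges, and the weak error of the second moment satisfies $$\mathbb{E}\|X_t\|^2-\mathbb{E}\|X_t^m\|^2 = 2\sum_{k=m+1}^\infty\big\|\varphi^{\cos}_{k,t}(L)B\big\|_F^2 .$$ If moreover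 $L$ is symmetric negative semidefinite and $m\ge2$, then $$\mathbb{E}\|X_t\|^2-\mathbb{E}\|X_t^m\|^2\le\frac{2\|B\|^2}{\pi^2}\,\frac{n}{m-1} ,$$ i.e. weak order $1$ in $m$. -/

import Mathlib

open MeasureTheory ProbabilityTheory
open scoped NNReal

namespace KLSampling

variable {n : ℕ} {Ω : Type*}

/-- The state space `ℝⁿ` with the Euclidean norm. -/
abbrev Vec (n : ℕ) : Type := EuclideanSpace ℝ (Fin n)

/-- The linear operator `x ↦ A x` on Euclidean space; its operator norm is the spectral norm
`‖A‖ = ‖A‖₂`. -/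
noncomputable abbrev op (A : Matrix (Fin n) (Fin n) ℝ) : Vec n →L[ℝ] Vec n :=
  Matrix.toEuclideanCLM (𝕜 := ℝ) A

open scoped Matrix.Norms.Frobenius in
/-- The Frobenius norm of a real square matrix. -/
noncomputable def frobeniusNorm (A : Matrix (Fin n) (Fin n) ℝ) : ℝ := ‖A‖

/-- A standard `n`-dimensional Wiener process: the components are independent standard
one-dimensional Brownian motions (started at `0`, with almost surely continuous paths). -/
structure IsWiener [MeasurableSpace Ω] (W : ℝ≥0 → Ω → Vec n) (P : Measure Ω) : Prop where
  brownian : ∀ i, IsBrownianReal (fun t ω => W t ω i) P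
  indep : iIndepFun (fun (i : Fin n) (ω : Ω) (t : ℝ≥0) => W t ω i) P

/-- `X` is a solution of `dX = L X dt + B dW` with `X 0 = x₀`: its paths are almost surely
continuous and satisfy `X t = x₀ + ∫₀ᵗ L X s ds + ∫₀ᵗ B dW s` for all `t ≥ 0`. Since the integrand
`B` is constant and `W 0 = 0`, all Riemann sums of the Itô integral telescope and
`∫₀ᵗ B dW s = B W t`. -/
structure IsSDESolution [MeasurableSpace Ω] (L B : Matrix (Fin n) (Fin n) ℝ) (x₀ : Vec n)
    (W X : ℝ≥0 → Ω → Vec n) (P : Measure Ω) : Prop where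
  continuous_paths : ∀ᵐ ω ∂P, Continuous (fun t => X t ω)
  integral_eq : ∀ᵐ ω ∂P, ∀ t : ℝ≥0,
    X t ω = x₀ + (∫ s in (0 : ℝ)..t, op L (X s.toNNReal ω)) + op B (W t ω)

/-- The Karhunen–Loève frequencies `λ_k = (k - 1/2) π`, used for `k ≥ 1`. -/
noncomputable def freq (k : ℕ) : ℝ := ((k : ℝ) - 1 / 2) * Real.pi

/-- The matrix function
`φ^cos_{k,t}(L) = ∫₀ᵗ exp ((t - s) L) cos (λ_k s) ds` (an entrywise integral). -/
noncomputable def phiCos (k : ℕ) (t : ℝ) (L : Matrix (Fin n) (Fin n) ℝ) :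
    Matrix (Fin n) (Fin n) ℝ :=
  Matrix.of fun i j =>
    ∫ s in (0 : ℝ)..t, (NormedSpace.exp ((t - s) • L)) i j * Real.cos (freq k * s)

/-- `Z 1, Z 2, …` are independent standard normal random vectors in `ℝⁿ`: all their components
are jointly independent and `N(0,1)`-distributed. (`Z 0` is not used.) -/
structure IsStdNormalSeq [MeasurableSpace Ω] (Z : ℕ → Ω → Vec n) (P : Measure Ω) : Prop where
  law : ∀ (k : ℕ) (i : Fin n), HasLaw (fun ω => Z (k + 1) ω i) (gaussianReal 0 1) P
  indep : iIndepFun (fun (p : ℕ × Fin n) (ω : Ω) => Z (p.1 + 1) ω p.2) P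

/-- The approximation `X_t^m = exp (t L) x₀ + √2 ∑_{k=1}^m φ^cos_{k,t}(L) B Z_k`. -/
noncomputable def klApprox (L B : Matrix (Fin n) (Fin n) ℝ) (x₀ : Vec n) (Z : ℕ → Ω → Vec n)
    (m : ℕ) (t : ℝ) (ω : Ω) : Vec n :=
  op (NormedSpace.exp (t • L)) x₀ +
    √2 • ∑ k ∈ Finset.Icc 1 m, op (phiCos k t L * B) (Z k ω)

end KLSampling

/-!
Both second moments are computed exactly and then compared term by term.

Write `g s = exp ((t - s) L) B`. Subtracting `B W` from the solution leaves a pathwise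
differentiable function, so variation of constants gives `X t = exp (t L) x₀ + ∫₀ᵗ g dW`, where
the Wiener integral of the smooth function `g` is read through integration by parts
(`variation_of_constants`, `wienerInt`). Fubini's theorem and `E (W s W r) = min s r` yield Itô's
isometry (`integral_wienerInt_mul_wienerInt`), hence
`E ‖X t‖² = ‖exp (t L) x₀‖² + ∑ᵢⱼ ∫₀ᵗ gᵢⱼ²`. The entries of `φ^cos_{k,t}(L) B` are the coefficients
of `gᵢⱼ 1_[0,t]` in the orthonormal basis `√2 cos (λ_k s)` of `L²[0, 1]`, so Parseval's identity
(`hasSum_sq_integral_mul_cos`) turns the last term into `2 ∑_{k ≥ 1} ‖φ^cos_{k,t}(L) B‖_F²`, of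
which the truncated expansion has exactly the first `m` terms.

For symmetric negative semidefinite `L`, an orthonormal eigenbasis reduces the bound to the scalar
estimate `∑_{k > m} c_k² ≤ 1 / (π² (m - 1))` for `c_k = ∫₀ᵗ exp (-a (t - s)) cos (λ_k s) ds`,
uniformly in `a ≥ 0` (`sum_sq_expCos_freq_le`). The pointwise bound `|c_k| ≤ 1 / λ_k` fails in
general, because of the term `a exp (-a t) / (a² + λ_k²)` in the closed form of `c_k`. If
`a exp (-a t) ≤ π`, that term is of second order in `1 / λ_k` and the gap between `m`
and `m - 1` absorbs it. Otherwise `t ≤ 1 / 8`. Then the bound `1 / λ_k` does hold as long as `λ_k t ≤ π`, and beyond that point the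
squared trigonometric part averages to half of `1 / λ_k²`, the oscillation being controlled by
summation by parts; this leaves room for the exponential part.
-/

namespace KLSampling

/-! ### Parseval identity for the cosine basis -/

/-- For an even real function, integrating against `exp (-i c s)` over `[-1, 1]` is twice
integrating against `cos (c s)` over `[0, 1]`. -/
lemma integral_exp_mul_even {F : ℝ → ℝ} (hF : ∀ s, F (-s) = F s)
    (hi : IntervalIntegrable F volume 0 1) (c : ℝ) :
    ∫ s in (-1 : ℝ)..1, Complex.exp (-(c * s : ℝ) * Complex.I) * (F s : ℂ) =
      ((2 * ∫ s in (0 : ℝ)..1, F s * Real.cos (c * s) : ℝ) : ℂ) := by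
  have hi' : IntervalIntegrable (fun s => (F s : ℂ)) volume 0 1 :=
    ⟨hi.1.ofReal, hi.2.ofReal⟩
  have h1 : ∀ d : ℝ, IntervalIntegrable
      (fun s : ℝ => Complex.exp (-(d * s : ℝ) * Complex.I) * (F s : ℂ)) volume 0 1 := fun d =>
    hi'.continuousOn_mul (by fun_prop)
  have h2 : IntervalIntegrable
      (fun s : ℝ => Complex.exp (-(c * s : ℝ) * Complex.I) * (F s : ℂ)) volume (-1) 0 := by
    have := (h1 (-c)).comp_sub_left 0
    refine (IntervalIntegrable.congr (fun s _ => ?_) this.symm).mono_set ?_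
    · simp [hF]
    · simp
  rw [← intervalIntegral.integral_add_adjacent_intervals h2 (h1 c)]
  have h3 := intervalIntegral.integral_comp_neg (a := 0) (b := 1)
    (fun s : ℝ => Complex.exp (-(c * s : ℝ) * Complex.I) * (F s : ℂ))
  rw [neg_zero] at h3
  rw [← h3, ← intervalIntegral.integral_add _ (h1 c)]
  · rw [← intervalIntegral.integral_const_mul, ← intervalIntegral.integral_ofReal]
    refine intervalIntegral.integral_congr fun s _ => ?_
    simp only [hF, mul_neg, neg_neg, Complex.ofReal_neg, Complex.ofReal_mul, Complex.ofReal_cos,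
      Complex.cos, Complex.ofReal_ofNat]
    ring
  · refine IntervalIntegrable.congr (fun s _ => ?_) (h1 (-c))
    simp [hF]

lemma freq_succ (j : ℕ) : freq (j + 1) = ((j : ℝ) + 1 / 2) * Real.pi := by
  unfold freq; push_cast; ring

/-- Parseval's identity for the orthonormal basis `√2 cos (λ_k s)`, `k ≥ 1`, of `L²[0, 1]`, applied
to a function cut off at `t ≤ 1`. It is the complex Parseval identity on `[-1, 1]` for the even
extension multiplied by `exp (-i π s / 2)`, which moves the integer frequencies `n π` to
`(n + 1/2) π`. -/
theorem hasSum_sq_integral_mul_cos {f : ℝ → ℝ} (hf : Continuous f) {t : ℝ} (ht0 : 0 ≤ t)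
    (ht : t ≤ 1) :
    HasSum (fun j : ℕ => (∫ s in (0 : ℝ)..t, f s * Real.cos (freq (j + 1) * s)) ^ 2)
      (1 / 2 * ∫ s in (0 : ℝ)..t, f s ^ 2) := by
  set F : ℝ → ℝ := fun s => if |s| ≤ t then f |s| else 0 with hFdef
  have hFm : Measurable F := by
    refine Measurable.ite (measurableSet_le (by fun_prop) measurable_const) ?_ measurable_const
    exact (hf.comp continuous_abs).measurable
  obtain ⟨C, hC⟩ := (isCompact_Icc (a := (0 : ℝ)) (b := t)).exists_bound_of_continuousOn
    hf.continuousOn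
  have hFb : ∀ s, ‖F s‖ ≤ C := by
    intro s
    by_cases hs : |s| ≤ t
    · simpa [F, hs] using hC |s| ⟨abs_nonneg s, hs⟩
    · simpa [F, hs] using (norm_nonneg _).trans (hC 0 ⟨le_rfl, ht0⟩)
  have hcut : ∀ G : ℝ → ℝ → ℝ, (∀ s, G 0 s = 0) →
      (∀ s, IntervalIntegrable (fun s => G (F s) s) volume 0 s) →
      ∫ s in (0 : ℝ)..1, G (F s) s = ∫ s in (0 : ℝ)..t, G (f s) s := by
    intro G hG hGi
    rw [← intervalIntegral.integral_add_adjacent_intervals (hGi t) ((hGi t).symm.trans (hGi 1))]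
    have hz : ∫ s in t..1, G (F s) s = 0 := by
      rw [intervalIntegral.integral_of_le ht]
      refine setIntegral_eq_zero_of_forall_eq_zero fun s hs => ?_
      have : ¬ |s| ≤ t := by rw [abs_of_pos (ht0.trans_lt hs.1)]; exact not_le.2 hs.1
      simp [F, this, hG]
    rw [hz, add_zero]
    refine intervalIntegral.integral_congr fun s hs => ?_
    rw [Set.uIcc_of_le ht0] at hs
    simp [F, abs_of_nonneg hs.1, hs.2]
  have hint : ∀ (G : ℝ → ℝ), Measurable G → (∃ D, ∀ s, ‖G s‖ ≤ D) → ∀ s,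
      IntervalIntegrable G volume 0 s := by
    rintro G hG ⟨D, hD⟩ s
    exact (intervalIntegrable_const (c := D)).mono_fun hG.aestronglyMeasurable
      (Filter.Eventually.of_forall fun s => by
        simpa using (hD s).trans (le_abs_self D))
  have hFi : IntervalIntegrable F volume 0 1 := hint F hFm ⟨C, hFb⟩ 1
  have hFe : ∀ s, F (-s) = F s := fun s => by simp [F]
  set H : ℝ → ℂ := fun s => Complex.exp (-(Real.pi / 2 * s : ℝ) * Complex.I) * (F s : ℂ) with hH
  have hHn : ∀ s, ‖H s‖ = ‖F s‖ := by
    intro s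
    rw [hH, norm_mul, ← Complex.ofReal_neg, Complex.norm_exp_ofReal_mul_I, one_mul,
      Complex.norm_real]
  have hHm : MemLp H 2 (volume.restrict (Set.Ioc (-1) 1)) := by
    refine MemLp.of_bound (C := C) ?_
      (Filter.Eventually.of_forall fun s => (hHn s).le.trans (hFb s))
    refine AEStronglyMeasurable.mul (by fun_prop) ?_
    exact (Complex.measurable_ofReal.comp hFm).aestronglyMeasurable
  have hlt : (-1 : ℝ) < 1 := by norm_num
  have key := hasSum_sq_fourierCoeffOn hlt hHm
  have hcoeff : ∀ n : ℤ, fourierCoeffOn hlt H n =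
      ((∫ s in (0 : ℝ)..t, f s * Real.cos (((n : ℝ) + 1 / 2) * Real.pi * s) : ℝ) : ℂ) := by
    intro n
    rw [← hcut (fun x s => x * Real.cos (((n : ℝ) + 1 / 2) * Real.pi * s)) (by simp)]
    · rw [fourierCoeffOn_eq_integral]
      have h := integral_exp_mul_even hFe hFi (((n : ℝ) + 1 / 2) * Real.pi)
      rw [Complex.ofReal_mul] at h
      have h' : ∀ x : ℂ, (∫ x in (-1 : ℝ)..1,
          fourier (-n) (x : AddCircle ((1 : ℝ) - -1)) • H x) = (2 : ℝ) * x →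
          (1 / ((1 : ℝ) - -1)) • (∫ x in (-1 : ℝ)..1,
            fourier (-n) (x : AddCircle ((1 : ℝ) - -1)) • H x) = x := by
        intro x hx
        rw [hx, Complex.real_smul]; push_cast; ring
      refine h' _ (Eq.trans ?_ h)
      refine intervalIntegral.integral_congr fun s _ => ?_
      simp only [hH, fourier_coe_apply, smul_eq_mul]
      rw [← mul_assoc, ← Complex.exp_add]
      congr 2
      push_cast
      ring
    · refine fun s => hint _ (hFm.mul (by fun_prop)) ⟨C, fun s => ?_⟩ s
      rw [Pi.mul_apply, norm_mul]
      exact (mul_le_of_le_one_right (norm_nonneg _) (Real.abs_cos_le_one _)).trans (hFb s)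
  have hnorm : ((1 : ℝ) - -1)⁻¹ • ∫ s in (-1 : ℝ)..1, ‖H s‖ ^ 2 =
      ∫ s in (0 : ℝ)..t, f s ^ 2 := by
    have hF2 : IntervalIntegrable (fun s => F s ^ 2) volume 0 1 :=
      hint _ (hFm.pow_const 2) ⟨C ^ 2, fun s => by
        rw [norm_pow]; exact pow_le_pow_left₀ (norm_nonneg _) (hFb s) 2⟩ 1
    have h := integral_exp_mul_even (F := fun s => F s ^ 2) (fun s => by simp [hFe]) hF2 0
    simp only [zero_mul, Complex.ofReal_zero, neg_zero, Complex.exp_zero, one_mul, Real.cos_zero,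
      mul_one, intervalIntegral.integral_ofReal, Complex.ofReal_inj] at h
    simp only [hHn, Real.norm_eq_abs, sq_abs]
    rw [h, hcut (fun x _ => x ^ 2) (by simp)]
    · simp; ring
    · exact hint _ (hFm.pow_const 2) ⟨C ^ 2, fun s => by
        rw [norm_pow]; exact pow_le_pow_left₀ (norm_nonneg _) (hFb s) 2⟩
  rw [hnorm] at key
  have hterm : ∀ j : ℕ, (∫ s in (0 : ℝ)..t, f s * Real.cos (freq (j + 1) * s)) ^ 2 =
      1 / 2 * (‖fourierCoeffOn hlt H j‖ ^ 2 + ‖fourierCoeffOn hlt H (-((j : ℤ) + 1))‖ ^ 2) := by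
    intro j
    -- the integer indices `j` and `-(j + 1)` carry the frequencies `± freq (j + 1)`
    have hneg : ∀ s : ℝ, Real.cos ((((-((j : ℤ) + 1) : ℤ) : ℝ) + 1 / 2) * Real.pi * s) =
        Real.cos (freq (j + 1) * s) := by
      intro s
      rw [← Real.cos_neg, freq_succ]
      congr 1
      push_cast
      ring
    simp only [hcoeff, hneg, Complex.norm_real, Real.norm_eq_abs, sq_abs, freq_succ,
      Int.cast_natCast]
    ring
  simp_rw [hterm]
  exact key.nat_add_neg_add_one.mul_left (1 / 2)

/-! ### The scalar coefficients and their tails -/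

/-- The closed form of `∫₀ᵗ exp (-a (t - s)) cos (l s) ds` for `l > 0`, see
`integral_exp_mul_cos`. -/
noncomputable def expCos (a l t : ℝ) : ℝ :=
  (l * Real.sin (l * t) + a * Real.cos (l * t) - a * Real.exp (-(a * t))) / (a ^ 2 + l ^ 2)

lemma integral_exp_mul_cos (a : ℝ) {l : ℝ} (hl : 0 < l) (t : ℝ) :
    ∫ s in (0 : ℝ)..t, Real.exp (-(a * (t - s))) * Real.cos (l * s) = expCos a l t := by
  have hR : a ^ 2 + l ^ 2 ≠ 0 := by positivity
  have hd : ∀ s : ℝ, HasDerivAt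
      (fun s => Real.exp (-(a * (t - s))) * (l * Real.sin (l * s) + a * Real.cos (l * s)) /
        (a ^ 2 + l ^ 2)) (Real.exp (-(a * (t - s))) * Real.cos (l * s)) s := by
    intro s
    have h1 : HasDerivAt (fun s : ℝ => -(a * (t - s))) a s := by
      simpa [Pi.neg_def] using (((hasDerivAt_id s).const_sub t).const_mul a).neg
    have h2 : HasDerivAt (fun s : ℝ => l * s) l s := by
      simpa using (hasDerivAt_id s).const_mul l
    have h3 := ((h1.exp).mul ((h2.sin.const_mul l).add (h2.cos.const_mul a))).div_const
      (a ^ 2 + l ^ 2)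
    refine h3.congr_deriv ?_
    simp only [Pi.add_apply]
    field_simp
    ring
  rw [intervalIntegral.integral_eq_sub_of_hasDerivAt (fun s _ => hd s)
    (Continuous.intervalIntegrable (by fun_prop) _ _)]
  simp [expCos]
  ring

/-- Cauchy–Schwarz for the trigonometric part of `expCos`. -/
lemma sq_trig_le (a l θ : ℝ) : (l * Real.sin θ + a * Real.cos θ) ^ 2 ≤ a ^ 2 + l ^ 2 := by
  nlinarith [sq_nonneg (l * Real.cos θ - a * Real.sin θ), Real.sin_sq_add_cos_sq θ]

lemma abs_trig_div_le (a θ : ℝ) {l : ℝ} (hl : 0 < l) :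
    |(l * Real.sin θ + a * Real.cos θ) / (a ^ 2 + l ^ 2)| ≤ 1 / l := by
  have hR : 0 < a ^ 2 + l ^ 2 := by positivity
  refine abs_le_of_sq_le_sq ?_ (by positivity)
  rw [div_pow, div_pow, div_le_div_iff₀ (by positivity) (by positivity)]
  have h1 := sq_trig_le a l θ
  have h2 : l ^ 2 ≤ a ^ 2 + l ^ 2 := by nlinarith
  calc _ ≤ (a ^ 2 + l ^ 2) * (a ^ 2 + l ^ 2) := mul_le_mul h1 h2 (by positivity) hR.le
    _ = _ := by ring

lemma abs_expCos_le_add {a l : ℝ} (ha : 0 ≤ a) (hl : 0 < l) (t : ℝ) :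
    |expCos a l t| ≤ 1 / l + a * Real.exp (-(a * t)) / l ^ 2 := by
  unfold expCos
  rw [sub_div]
  refine (abs_sub _ _).trans (add_le_add (abs_trig_div_le a _ hl) ?_)
  rw [abs_of_nonneg (by positivity)]
  exact div_le_div_of_nonneg_left (by positivity) (by positivity) (by nlinarith)

/-- Up to the phase `π` the coefficient obeys the bound `1 / l`; for larger phases this bound can
fail. -/
lemma abs_expCos_le_of_le_pi {a l t : ℝ} (ha : 0 ≤ a) (hl : 0 < l) (ht : 0 ≤ t)
    (h : l * t ≤ Real.pi) : |expCos a l t| ≤ 1 / l := by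
  have hR : 0 < a ^ 2 + l ^ 2 := by positivity
  have hs := Real.sin_nonneg_of_nonneg_of_le_pi (by positivity) h
  have hc := Real.neg_one_le_cos (l * t)
  have he : Real.exp (-(a * t)) ≤ 1 := Real.exp_le_one_iff.2 (by simp; positivity)
  have he0 := Real.exp_pos (-(a * t))
  unfold expCos
  rw [abs_le]
  constructor
  · rw [← neg_div, div_le_div_iff₀ hl hR]
    nlinarith [sq_nonneg (a - l), mul_nonneg hl.le hs, mul_nonneg (mul_nonneg hl.le hl.le) hs,
      mul_nonneg (mul_nonneg hl.le ha) (sub_nonneg.2 he),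
      mul_nonneg (mul_nonneg hl.le ha) (by linarith : 0 ≤ Real.cos (l * t) + 1)]
  · have h1 := (abs_le.1 (abs_trig_div_le a (l * t) hl)).2
    refine le_trans ?_ h1
    gcongr
    have : 0 ≤ a * Real.exp (-(a * t)) := by positivity
    linarith

/-- Summation by parts for a power series on the unit circle whose coefficients have variation
controlled by a decreasing sequence. -/
lemma norm_one_sub_mul_norm_sum_le {c : ℕ → ℂ} {v : ℕ → ℝ} (hc : ∀ j, ‖c j‖ ≤ v j)
    (hd : ∀ j, ‖c (j + 1) - c j‖ ≤ v j - v (j + 1)) {z : ℂ} (hz : ‖z‖ = 1) (N : ℕ) :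
    ‖1 - z‖ * ‖∑ j ∈ Finset.range N, c j * z ^ j‖ ≤ 2 * v 0 := by
  have hid : (1 - z) * ∑ j ∈ Finset.range N, c j * z ^ j =
      c 0 + ∑ j ∈ Finset.range N, (c (j + 1) - c j) * z ^ (j + 1) - c N * z ^ N := by
    induction N with
    | zero => simp
    | succ N ih => rw [Finset.sum_range_succ, Finset.sum_range_succ, mul_add, ih]; ring
  have hsum : ‖∑ j ∈ Finset.range N, (c (j + 1) - c j) * z ^ (j + 1)‖ ≤ v 0 - v N := by
    rw [← Finset.sum_range_sub' v N]
    refine norm_sum_le_of_le _ fun j _ => ?_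
    simpa [hz] using hd j
  rw [← norm_mul, hid]
  refine (norm_sub_le _ _).trans ?_
  have h1 := norm_add_le (c 0) (∑ j ∈ Finset.range N, (c (j + 1) - c j) * z ^ (j + 1))
  have h2 : ‖c N * z ^ N‖ ≤ v N := by simpa [hz] using hc N
  linarith [hc 0]

/-- The square of the trigonometric part of `expCos` is a mean `1 / (2 (a² + l²))` plus an
oscillation. -/
lemma sq_trig_div_eq (a t : ℝ) {l : ℝ} (hl : 0 < l) :
    ((l * Real.sin (l * t) + a * Real.cos (l * t)) / (a ^ 2 + l ^ 2)) ^ 2 =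
      1 / (2 * (a ^ 2 + l ^ 2)) -
        1 / 2 * (Complex.exp ((2 * l * t : ℝ) * Complex.I) *
          (1 / ((l : ℂ) - a * Complex.I) ^ 2)).re := by
  have hR : a ^ 2 + l ^ 2 ≠ 0 := by positivity
  have hR' : (a : ℂ) ^ 2 + (l : ℂ) ^ 2 ≠ 0 := by exact_mod_cast hR
  have hfac : ((l : ℂ) - a * Complex.I) * (l + a * Complex.I) = (a : ℂ) ^ 2 + (l : ℂ) ^ 2 := by
    linear_combination (-(a : ℂ) ^ 2) * Complex.I_sq
  have hne : (l : ℂ) - a * Complex.I ≠ 0 := left_ne_zero_of_mul (hfac ▸ hR')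
  have hinv : 1 / ((l : ℂ) - a * Complex.I) ^ 2 =
      (((l ^ 2 - a ^ 2) / (a ^ 2 + l ^ 2) ^ 2 : ℝ) : ℂ) +
        ((2 * a * l / (a ^ 2 + l ^ 2) ^ 2 : ℝ) : ℂ) * Complex.I := by
    push_cast
    rw [← hfac]
    have hne2 : (l : ℂ) + a * Complex.I ≠ 0 := right_ne_zero_of_mul (hfac ▸ hR')
    field_simp
    linear_combination ((a : ℂ) ^ 2) * Complex.I_sq
  rw [hinv]
  simp only [Complex.mul_re, Complex.add_re, Complex.add_im, Complex.ofReal_re, Complex.ofReal_im,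
    Complex.mul_im, Complex.I_re, Complex.I_im, Complex.exp_ofReal_mul_I_re,
    Complex.exp_ofReal_mul_I_im]
  have h2 : 2 * l * t = 2 * (l * t) := by ring
  rw [h2, Real.cos_two_mul, Real.sin_two_mul]
  have hsc := Real.sin_sq_add_cos_sq (l * t)
  generalize Real.sin (l * t) = x at *
  generalize Real.cos (l * t) = y at *
  field_simp
  linear_combination (2 * l ^ 2) * hsc

lemma norm_inv_sq_le (a : ℝ) {l : ℝ} (hl : 0 < l) :
    ‖1 / ((l : ℂ) - a * Complex.I) ^ 2‖ ≤ 1 / l ^ 2 := by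
  have h := Complex.abs_re_le_norm ((l : ℂ) - a * Complex.I)
  rw [norm_div, norm_one, norm_pow]
  simp [abs_of_pos hl] at h
  gcongr

lemma norm_inv_sq_sub_inv_sq_le (a : ℝ) {l l' : ℝ} (hl : 0 < l) (hll : l ≤ l') :
    ‖1 / ((l' : ℂ) - a * Complex.I) ^ 2 - 1 / ((l : ℂ) - a * Complex.I) ^ 2‖ ≤
      1 / l ^ 2 - 1 / l' ^ 2 := by
  have hl' : 0 < l' := hl.trans_le hll
  have hb : ∀ x : ℝ, 0 < x → x ≤ ‖(x : ℂ) - a * Complex.I‖ := by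
    intro x hx
    have h := Complex.abs_re_le_norm ((x : ℂ) - a * Complex.I)
    simpa [abs_of_pos hx] using h
  have h1 := hb l hl
  have h2 := hb l' hl'
  set w : ℂ := (l : ℂ) - a * Complex.I with hw
  set w' : ℂ := (l' : ℂ) - a * Complex.I with hw'
  have n1 : 0 < ‖w‖ := hl.trans_le h1
  have n2 : 0 < ‖w'‖ := hl'.trans_le h2
  have e1 : w ≠ 0 := norm_pos_iff.1 n1
  have e2 : w' ≠ 0 := norm_pos_iff.1 n2
  have hdiff : ‖w' - w‖ = l' - l := by
    have : w' - w = ((l' - l : ℝ) : ℂ) := by rw [hw, hw']; push_cast; ring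
    rw [this, Complex.norm_real, Real.norm_of_nonneg (by linarith)]
  have hid : 1 / w' ^ 2 - 1 / w ^ 2 = -((w' - w) * (1 / (w * w' ^ 2) + 1 / (w ^ 2 * w'))) := by
    field_simp
    ring
  rw [hid, norm_neg, norm_mul, hdiff]
  have hsum : ‖1 / (w * w' ^ 2) + 1 / (w ^ 2 * w')‖ ≤ 1 / (l * l' ^ 2) + 1 / (l ^ 2 * l') := by
    refine (norm_add_le _ _).trans (add_le_add ?_ ?_) <;>
    · rw [norm_div, norm_one, norm_mul, norm_pow]
      gcongr
  calc (l' - l) * ‖1 / (w * w' ^ 2) + 1 / (w ^ 2 * w')‖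
      ≤ (l' - l) * (1 / (l * l' ^ 2) + 1 / (l ^ 2 * l')) :=
        mul_le_mul_of_nonneg_left hsum (by linarith)
    _ = _ := by field_simp; ring

lemma freq_pos {k : ℕ} (hk : 1 ≤ k) : 0 < freq k := by
  have : (1 : ℝ) ≤ k := by exact_mod_cast hk
  exact mul_pos (by linarith) Real.pi_pos

/-- The oscillating part of the squared coefficients sums to at most
`1 / (λ_{m+1}² sin (π t))`. -/
lemma abs_sum_oscillation_le (a : ℝ) {t : ℝ} (ht0 : 0 < t) (ht1 : t < 1) (m N : ℕ) :
    |∑ j ∈ Finset.range N, (Complex.exp ((2 * freq (m + 1 + j) * t : ℝ) * Complex.I) *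
      (1 / ((freq (m + 1 + j) : ℂ) - a * Complex.I) ^ 2)).re| ≤
      1 / (freq (m + 1) ^ 2 * Real.sin (Real.pi * t)) := by
  have hsin : 0 < Real.sin (Real.pi * t) :=
    Real.sin_pos_of_pos_of_lt_pi (by positivity) (by nlinarith [Real.pi_pos])
  have hpos : ∀ j, 0 < freq (m + 1 + j) := fun j => freq_pos (by omega)
  set z : ℂ := Complex.exp (Complex.I * (2 * Real.pi * t : ℝ)) with hzdef
  have hz : ‖z‖ = 1 := by rw [hzdef, mul_comm, Complex.norm_exp_ofReal_mul_I]
  have hz1 : ‖1 - z‖ = 2 * Real.sin (Real.pi * t) := by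
    rw [norm_sub_rev, hzdef, Complex.norm_exp_I_mul_ofReal_sub_one, Real.norm_eq_abs,
      show 2 * Real.pi * t / 2 = Real.pi * t by ring, abs_of_pos (by positivity)]
  have habel := norm_one_sub_mul_norm_sum_le
    (c := fun j => 1 / ((freq (m + 1 + j) : ℂ) - a * Complex.I) ^ 2)
    (v := fun j => 1 / freq (m + 1 + j) ^ 2) (fun j => norm_inv_sq_le a (hpos j))
    (fun j => norm_inv_sq_sub_inv_sq_le a (hpos j) (by
      unfold freq; push_cast; nlinarith [Real.pi_pos])) hz N
  have hfac : ∀ j, Complex.exp ((2 * freq (m + 1 + j) * t : ℝ) * Complex.I) =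
      Complex.exp ((2 * freq (m + 1) * t : ℝ) * Complex.I) * z ^ j := by
    intro j
    rw [hzdef, ← Complex.exp_nat_mul, ← Complex.exp_add]
    congr 1
    unfold freq
    push_cast
    ring
  rw [← Complex.re_sum]
  refine (Complex.abs_re_le_norm _).trans ?_
  have : ∑ j ∈ Finset.range N, Complex.exp ((2 * freq (m + 1 + j) * t : ℝ) * Complex.I) *
      (1 / ((freq (m + 1 + j) : ℂ) - a * Complex.I) ^ 2) =
      Complex.exp ((2 * freq (m + 1) * t : ℝ) * Complex.I) *
        ∑ j ∈ Finset.range N, 1 / ((freq (m + 1 + j) : ℂ) - a * Complex.I) ^ 2 * z ^ j := by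
    rw [Finset.mul_sum]
    refine Finset.sum_congr rfl fun j _ => ?_
    rw [hfac]
    ring
  rw [this, norm_mul, Complex.norm_exp_ofReal_mul_I, one_mul]
  rw [hz1, add_zero] at habel
  rw [← div_div, le_div_iff₀ hsin]
  linarith

lemma mul_exp_neg_le (x : ℝ) : x * Real.exp (-x) ≤ Real.exp (-1) := by
  have h : x ≤ Real.exp (x - 1) := by linarith [Real.add_one_le_exp (x - 1)]
  calc x * Real.exp (-x) ≤ Real.exp (x - 1) * Real.exp (-x) := by gcongr
    _ = Real.exp (-1) := by rw [← Real.exp_add]; congr 1; ring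

lemma sum_one_div_freq_sq_le {m : ℕ} (hm : 1 ≤ m) (N : ℕ) :
    ∑ j ∈ Finset.range N, 1 / freq (m + 1 + j) ^ 2 ≤ 1 / (Real.pi ^ 2 * m) := by
  have hm' : (1 : ℝ) ≤ m := by exact_mod_cast hm
  have hpi := Real.pi_pos
  have h : ∀ j ∈ Finset.range N, 1 / freq (m + 1 + j) ^ 2 ≤
      1 / (Real.pi ^ 2 * ((m : ℝ) + j)) - 1 / (Real.pi ^ 2 * ((m : ℝ) + (j + 1 : ℕ))) := by
    intro j _
    have hj : (0 : ℝ) ≤ j := j.cast_nonneg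
    unfold freq
    push_cast
    have e : 1 / (Real.pi ^ 2 * ((m : ℝ) + j)) - 1 / (Real.pi ^ 2 * ((m : ℝ) + (j + 1))) =
        1 / (Real.pi ^ 2 * (((m : ℝ) + j) * (m + (j + 1)))) := by field_simp; ring
    rw [e, mul_pow]
    refine one_div_le_one_div_of_le (by positivity) ?_
    rw [mul_comm]
    gcongr
    nlinarith
  refine (Finset.sum_le_sum h).trans ?_
  rw [Finset.sum_range_sub' (fun j : ℕ => 1 / (Real.pi ^ 2 * ((m : ℝ) + j)))]
  simp only [Nat.cast_zero, add_zero]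
  have : 0 ≤ 1 / (Real.pi ^ 2 * ((m : ℝ) + N)) := by positivity
  linarith

lemma lt_exp_one_mul_pi : (8.5 : ℝ) < Real.exp 1 * Real.pi := by
  have h1 := Real.exp_one_gt_d9
  have h2 := Real.pi_gt_d2
  nlinarith

/-- Once the phase has passed `π`, the trigonometric part contributes, on average, only half of
`1 / λ_k²`, and the exponential part is a small fraction of `1 / λ_k²`. -/
lemma sum_sq_expCos_le_of_pi_le {a t : ℝ} (ha : 0 ≤ a) (ht : t ≤ 1 / 8) {m : ℕ}
    (hm : 1 ≤ m) (h : Real.pi ≤ freq (m + 1) * t) (N : ℕ) :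
    ∑ j ∈ Finset.range N, expCos a (freq (m + 1 + j)) t ^ 2 ≤ 1 / (Real.pi ^ 2 * m) := by
  have hpi := Real.pi_pos
  have hpi3 := Real.pi_gt_d2
  have hpi4 := Real.pi_lt_d2
  have hf0 : 0 < freq (m + 1) := freq_pos (by omega)
  have ht0 : 0 < t := pos_of_mul_pos_right (hpi.trans_le h) hf0.le
  have hpos : ∀ j, 0 < freq (m + 1 + j) := fun j => freq_pos (by omega)
  have hmono : ∀ j, freq (m + 1) ≤ freq (m + 1 + j) := fun j => by
    have hj : (0 : ℝ) ≤ j := j.cast_nonneg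
    unfold freq; push_cast; nlinarith
  have hm' : (1 : ℝ) ≤ m := by exact_mod_cast hm
  set osc : ℕ → ℝ := fun j => (Complex.exp ((2 * freq (m + 1 + j) * t : ℝ) * Complex.I) *
      (1 / ((freq (m + 1 + j) : ℂ) - a * Complex.I) ^ 2)).re with hosc
  have hd : a * Real.exp (-(a * t)) * t ≤ Real.exp (-1) := by
    have := mul_exp_neg_le (a * t)
    linarith
  have hexp : Real.exp (-1) * Real.exp 1 = 1 := by rw [← Real.exp_add]; simp
  -- the exponential part: `a exp (-a t) ≤ 1 / (e t) ≤ λ / (e π)`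
  have hE : ∀ j, (a * Real.exp (-(a * t)) / (a ^ 2 + freq (m + 1 + j) ^ 2)) ^ 2 ≤
      1 / 72 * (1 / freq (m + 1 + j) ^ 2) := by
    intro j
    set l := freq (m + 1 + j) with hl
    have hl0 : 0 < l := hpos j
    have hlt : Real.pi ≤ l * t := h.trans (by gcongr; exact hmono j)
    set d := a * Real.exp (-(a * t)) with hdd
    have hd0 : 0 ≤ d := by positivity
    have h1 : 8.5 * d ≤ l := by
      have e1 := lt_exp_one_mul_pi
      have e3 : d * t * Real.exp 1 ≤ 1 := by
        calc d * t * Real.exp 1 ≤ Real.exp (-1) * Real.exp 1 := by gcongr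
          _ = 1 := hexp
      have e4 : Real.exp 1 * Real.pi * d ≤ l := by
        calc Real.exp 1 * Real.pi * d ≤ Real.exp 1 * (l * t) * d := by gcongr
          _ = l * (d * t * Real.exp 1) := by ring
          _ ≤ l * 1 := by gcongr
          _ = l := mul_one l
      nlinarith
    have h2 : d / (a ^ 2 + l ^ 2) ≤ 1 / (8.5 * l) := by
      rw [div_le_div_iff₀ (by positivity) (by positivity)]
      nlinarith [sq_nonneg a]
    calc (d / (a ^ 2 + l ^ 2)) ^ 2 ≤ (1 / (8.5 * l)) ^ 2 := by gcongr
      _ = 1 / 72.25 * (1 / l ^ 2) := by field_simp; norm_num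
      _ ≤ _ := by gcongr; norm_num
  have hterm : ∀ j ∈ Finset.range N, expCos a (freq (m + 1 + j)) t ^ 2 ≤
      (5 / 8 + 5 / 72) * (1 / freq (m + 1 + j) ^ 2) - 5 / 8 * osc j := by
    intro j _
    have hA := sq_trig_div_eq a t (hpos j)
    have hR : 1 / (2 * (a ^ 2 + freq (m + 1 + j) ^ 2)) ≤ 1 / 2 * (1 / freq (m + 1 + j) ^ 2) := by
      have := hpos j
      rw [← one_div_mul_one_div]
      gcongr
      nlinarith [sq_nonneg a]
    have hEj := hE j
    unfold expCos
    rw [sub_div]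
    set A := (freq (m + 1 + j) * Real.sin (freq (m + 1 + j) * t) +
      a * Real.cos (freq (m + 1 + j) * t)) / (a ^ 2 + freq (m + 1 + j) ^ 2)
    set E := a * Real.exp (-(a * t)) / (a ^ 2 + freq (m + 1 + j) ^ 2)
    -- weights `5/4` and `5`: the mean of `A²` is only half of `1 / λ²`, so `E²` may cost more
    have hAE : (A - E) ^ 2 ≤ 5 / 4 * A ^ 2 + 5 * E ^ 2 := by nlinarith [sq_nonneg (A / 2 + 2 * E)]
    have ho : osc j = (Complex.exp ((2 * freq (m + 1 + j) * t : ℝ) * Complex.I) *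
      (1 / ((freq (m + 1 + j) : ℂ) - a * Complex.I) ^ 2)).re := rfl
    rw [← ho] at hA
    linarith
  refine (Finset.sum_le_sum hterm).trans ?_
  rw [Finset.sum_sub_distrib, ← Finset.mul_sum, ← Finset.mul_sum]
  have h1 := sum_one_div_freq_sq_le hm N
  have h2 := abs_sum_oscillation_le a ht0 (by linarith) m N
  -- `sin (π t) ≥ 0.96 π t ≥ 0.96 π² / λ_{m+1}`
  have hsin : 9.4 / freq (m + 1) ≤ Real.sin (Real.pi * t) := by
    have hx1 : Real.pi * t ≤ 0.4 := by nlinarith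
    have hx0 : 0 < Real.pi * t := by positivity
    have h3 := Real.sin_gt_sub_cube hx0
    have h4 : (Real.pi * t) ^ 2 ≤ 0.16 := by nlinarith
    have h5 : 0.96 * (Real.pi * t) ≤ Real.sin (Real.pi * t) := by nlinarith
    refine le_trans ?_ h5
    rw [div_le_iff₀ hf0]
    nlinarith
  have h3 : 1 / (freq (m + 1) ^ 2 * Real.sin (Real.pi * t)) ≤
      1 / (9.4 / Real.pi) * (1 / (Real.pi ^ 2 * m)) := by
    rw [one_div_mul_one_div]
    refine one_div_le_one_div_of_le (by positivity) ?_
    have : freq (m + 1) ^ 2 * (9.4 / freq (m + 1)) ≤ freq (m + 1) ^ 2 * Real.sin (Real.pi * t) := by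
      gcongr
    refine le_trans ?_ this
    have e : freq (m + 1) ^ 2 * (9.4 / freq (m + 1)) = 9.4 * freq (m + 1) := by field_simp
    have e' : 9.4 / Real.pi * (Real.pi ^ 2 * m) = 9.4 * (Real.pi * m) := by field_simp
    rw [e, e']
    unfold freq
    push_cast
    nlinarith
  have h4 : 1 / (9.4 / Real.pi) ≤ (0.34 : ℝ) := by
    rw [one_div_div, div_le_iff₀ (by norm_num)]
    linarith
  have h5 : 0 ≤ 1 / (Real.pi ^ 2 * (m : ℝ)) := by positivity
  have h6 := (abs_le.1 h2).1
  have h7 : 1 / (9.4 / Real.pi) * (1 / (Real.pi ^ 2 * (m : ℝ))) ≤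
      0.34 * (1 / (Real.pi ^ 2 * (m : ℝ))) := by gcongr
  change _ ≤ ∑ j ∈ Finset.range N, osc j at h6
  linarith

/-- Pointwise bound that telescopes, valid as long as `a exp (-a t) ≤ π`: the right-hand side
dominates `(1 / λ + π / λ²)²` at `λ = (k + 1/2) π`. -/
lemma sq_expCos_freq_le {a t : ℝ} (ha : 0 ≤ a) (hd : a * Real.exp (-(a * t)) ≤ Real.pi) {k : ℕ}
    (hk : 2 ≤ k) :
    expCos a (freq (k + 1)) t ^ 2 ≤
      1 / (Real.pi ^ 2 * ((k : ℝ) - 1)) - 1 / (Real.pi ^ 2 * (k : ℝ)) := by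
  have hk' : (2 : ℝ) ≤ k := by exact_mod_cast hk
  have hpi := Real.pi_pos
  have hf0 : 0 < freq (k + 1) := freq_pos (by omega)
  have h1 := abs_expCos_le_add ha hf0 t
  have h2 : |expCos a (freq (k + 1)) t| ≤ 1 / freq (k + 1) + Real.pi / freq (k + 1) ^ 2 := by
    refine h1.trans ?_
    gcongr
  have hq : freq (k + 1) = Real.pi * ((k : ℝ) + 1 / 2) := by unfold freq; push_cast; ring
  rw [← sq_abs]
  refine (pow_le_pow_left₀ (abs_nonneg _) h2 2).trans ?_
  rw [hq]
  have hk1 : (0 : ℝ) < k - 1 := by linarith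
  have e1 : (1 / (Real.pi * ((k : ℝ) + 1 / 2)) + Real.pi / (Real.pi * ((k : ℝ) + 1 / 2)) ^ 2) ^ 2 =
      ((k : ℝ) + 3 / 2) ^ 2 / (Real.pi ^ 2 * ((k : ℝ) + 1 / 2) ^ 4) := by
    field_simp; ring
  have e2 : 1 / (Real.pi ^ 2 * ((k : ℝ) - 1)) - 1 / (Real.pi ^ 2 * (k : ℝ)) =
      1 / (Real.pi ^ 2 * (((k : ℝ) - 1) * k)) := by field_simp; ring
  rw [e1, e2, div_le_div_iff₀ (by positivity) (by positivity)]
  have : ((k : ℝ) + 3 / 2) ^ 2 * (((k : ℝ) - 1) * k) ≤ ((k : ℝ) + 1 / 2) ^ 4 := by nlinarith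
  nlinarith [mul_le_mul_of_nonneg_left this (by positivity : 0 ≤ Real.pi ^ 2)]

/-- The tail bound for the scalar coefficients, uniform in the decay rate `a ≥ 0`. -/
theorem sum_sq_expCos_freq_le {a t : ℝ} (ha : 0 ≤ a) (ht0 : 0 ≤ t) (N : ℕ) {m : ℕ} (hm : 2 ≤ m) :
    ∑ j ∈ Finset.range N, expCos a (freq (m + 1 + j)) t ^ 2 ≤
      1 / (Real.pi ^ 2 * ((m : ℝ) - 1)) := by
  have hpi := Real.pi_pos
  have hm' : (2 : ℝ) ≤ m := by exact_mod_cast hm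
  by_cases hd : a * Real.exp (-(a * t)) ≤ Real.pi
  · have h : ∀ j ∈ Finset.range N, expCos a (freq (m + 1 + j)) t ^ 2 ≤
        1 / (Real.pi ^ 2 * ((m : ℝ) - 1 + j)) -
          1 / (Real.pi ^ 2 * ((m : ℝ) - 1 + (j + 1 : ℕ))) := by
      intro j _
      have := sq_expCos_freq_le ha hd (k := m + j) (by omega)
      rw [show m + 1 + j = m + j + 1 by omega]
      refine this.trans (le_of_eq ?_)
      push_cast
      congr 3 <;> ring
    refine (Finset.sum_le_sum h).trans ?_
    rw [Finset.sum_range_sub' (fun j : ℕ => 1 / (Real.pi ^ 2 * ((m : ℝ) - 1 + j)))]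
    have : 0 ≤ 1 / (Real.pi ^ 2 * ((m : ℝ) - 1 + N)) := by
      have : (0 : ℝ) ≤ N := N.cast_nonneg
      have : (0 : ℝ) ≤ (m : ℝ) - 1 + N := by linarith
      positivity
    simp only [Nat.cast_zero, add_zero]
    linarith
  · rw [not_le] at hd
    have ht : t ≤ 1 / 8 := by
      have h1 := mul_exp_neg_le (a * t)
      have h2 : Real.pi * t ≤ Real.exp (-1) := by nlinarith
      have h3 := lt_exp_one_mul_pi
      have hexp : Real.exp (-1) * Real.exp 1 = 1 := by rw [← Real.exp_add]; simp
      have h4 : Real.exp 1 * (Real.pi * t) ≤ 1 :=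
        calc Real.exp 1 * (Real.pi * t) ≤ Real.exp 1 * Real.exp (-1) := by gcongr
          _ = 1 := by rw [mul_comm, hexp]
      nlinarith
    induction N generalizing m with
    | zero =>
      have : (0 : ℝ) ≤ (m : ℝ) - 1 := by linarith
      simp only [Finset.range_zero, Finset.sum_empty]
      positivity
    | succ N ih =>
      rcases le_total Real.pi (freq (m + 1) * t) with hp | hp
      · refine (sum_sq_expCos_le_of_pi_le ha ht (by omega) hp (N + 1)).trans ?_
        have : (0 : ℝ) < (m : ℝ) - 1 := by linarith
        refine one_div_le_one_div_of_le (by positivity) ?_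
        gcongr
        linarith
      · rw [Finset.sum_range_succ']
        have h1 := ih (m := m + 1) (by omega) (by push_cast; linarith)
        have h2 : ∑ j ∈ Finset.range N, expCos a (freq (m + 1 + (j + 1))) t ^ 2 ≤
            1 / (Real.pi ^ 2 * m) := by
          push_cast at h1
          rw [add_sub_cancel_right] at h1
          refine le_trans (le_of_eq ?_) h1
          refine Finset.sum_congr rfl fun j _ => ?_
          rw [show m + 1 + (j + 1) = m + 1 + 1 + j by omega]
        have hf0 : 0 < freq (m + 1) := freq_pos (by omega)
        have h3 := abs_expCos_le_of_le_pi ha hf0 ht0 hp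
        have h4 : expCos a (freq (m + 1)) t ^ 2 ≤
            1 / (Real.pi ^ 2 * ((m : ℝ) - 1)) - 1 / (Real.pi ^ 2 * (m : ℝ)) := by
          rw [← sq_abs]
          refine (pow_le_pow_left₀ (abs_nonneg _) h3 2).trans ?_
          have hm1 : (0 : ℝ) < (m : ℝ) - 1 := by linarith
          have e2 : 1 / (Real.pi ^ 2 * ((m : ℝ) - 1)) - 1 / (Real.pi ^ 2 * (m : ℝ)) =
              1 / (Real.pi ^ 2 * (((m : ℝ) - 1) * m)) := by field_simp; ring
          rw [e2, div_pow, one_pow]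
          refine one_div_le_one_div_of_le (by positivity) ?_
          unfold freq
          push_cast
          rw [mul_pow, mul_comm]
          gcongr
          nlinarith
        simp only [add_zero]
        linarith

/-! ### Wiener integrals of smooth functions -/

section WienerIntegral

variable {Ω : Type*} [MeasurableSpace Ω] {P : Measure Ω}

/-- A process with almost surely continuous paths is jointly measurable up to null sets: it is the
limit of its discretizations in time. -/
lemma aestronglyMeasurable_uncurry [IsProbabilityMeasure P] {U : ℝ → Ω → ℝ}
    (hm : ∀ s, AEMeasurable (U s) P) (hc : ∀ᵐ ω ∂P, Continuous fun s => U s ω)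
    (μ : Measure ℝ) [SFinite μ] :
    AEStronglyMeasurable (fun p : ℝ × Ω => U p.1 p.2) (μ.prod P) := by
  choose u hu huU using hm
  let V : ℕ → ℝ × Ω → ℝ := fun N p => u ((⌊p.1 * ((N : ℝ) + 1)⌋ : ℝ) / ((N : ℝ) + 1)) p.2
  have hV : ∀ N, Measurable (V N) := by
    intro N
    have h1 : Measurable (fun q : ℤ × Ω => u ((q.1 : ℝ) / ((N : ℝ) + 1)) q.2) :=
      measurable_from_prod_countable_right fun k => hu ((k : ℝ) / ((N : ℝ) + 1))
    have h2 : Measurable (fun p : ℝ × Ω => (⌊p.1 * ((N : ℝ) + 1)⌋, p.2)) :=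
      (Int.measurable_floor.comp (by fun_prop)).prodMk measurable_snd
    exact h1.comp h2
  have hae : ∀ᵐ ω ∂P, ∀ (N : ℕ) (k : ℤ), U ((k : ℝ) / ((N : ℝ) + 1)) ω =
      u ((k : ℝ) / ((N : ℝ) + 1)) ω :=
    ae_all_iff.2 fun N => ae_all_iff.2 fun k => huU _
  refine aestronglyMeasurable_of_tendsto_ae Filter.atTop
    (fun N => (hV N).aestronglyMeasurable) ?_
  filter_upwards [Measure.quasiMeasurePreserving_snd.ae hae,
    Measure.quasiMeasurePreserving_snd.ae hc] with p hp hcont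
  have hlim : Filter.Tendsto (fun N : ℕ => (⌊p.1 * ((N : ℝ) + 1)⌋ : ℝ) / ((N : ℝ) + 1))
      Filter.atTop (nhds p.1) := by
    have h0 : Filter.Tendsto (fun N : ℕ => p.1 - 1 / ((N : ℝ) + 1)) Filter.atTop (nhds p.1) := by
      simpa using (tendsto_one_div_add_atTop_nhds_zero_nat (𝕜 := ℝ)).const_sub p.1
    refine tendsto_of_tendsto_of_tendsto_of_le_of_le h0 tendsto_const_nhds (fun N => ?_)
      (fun N => ?_)
    · have hN : (0 : ℝ) < (N : ℝ) + 1 := by positivity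
      rw [le_div_iff₀ hN, sub_mul, one_div_mul_cancel hN.ne']
      exact (Int.sub_one_lt_floor _).le
    · have hN : (0 : ℝ) < (N : ℝ) + 1 := by positivity
      rw [div_le_iff₀ hN]
      exact Int.floor_le _
  have := (hcont.tendsto p.1).comp hlim
  refine this.congr fun N => ?_
  exact hp N _

/-- A real process, indexed by `ℝ` for convenience, with the path and moment properties of Brownian
motion at times `s ≥ 0` that the second-moment computation uses. -/
structure IsWienerPath (U : ℝ → Ω → ℝ) (P : Measure Ω) : Prop where
  cont : ∀ᵐ ω ∂P, Continuous fun s => U s ω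
  memLp : ∀ s, MemLp (U s) 2 P
  mean : ∀ s, ∫ ω, U s ω ∂P = 0
  sq : ∀ s, 0 ≤ s → ∫ ω, U s ω ^ 2 ∂P = s

variable [IsProbabilityMeasure P] {U V : ℝ → Ω → ℝ} {t : ℝ}

lemma integrable_prod_of_bound {F : ℝ × Ω → ℝ}
    (hF : AEStronglyMeasurable F ((volume.restrict (Set.Ioc 0 t)).prod P)) {C : ℝ}
    (hi : ∀ s ∈ Set.Ioc 0 t, Integrable (fun ω => F (s, ω)) P)
    (hC : ∀ s ∈ Set.Ioc 0 t, ∫ ω, ‖F (s, ω)‖ ∂P ≤ C) :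
    Integrable F ((volume.restrict (Set.Ioc 0 t)).prod P) := by
  rw [integrable_prod_iff hF]
  refine ⟨(ae_restrict_iff' measurableSet_Ioc).2 (Filter.Eventually.of_forall hi), ?_⟩
  refine Integrable.mono' (integrable_const C) hF.norm.integral_prod_right' ?_
  refine (ae_restrict_iff' measurableSet_Ioc).2 (Filter.Eventually.of_forall fun s hs => ?_)
  rw [Real.norm_of_nonneg (integral_nonneg fun ω => norm_nonneg _)]
  exact hC s hs

namespace IsWienerPath

lemma aestronglyMeasurable_mul (hU : IsWienerPath U P) {h : ℝ → ℝ} (hh : Continuous h) :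
    AEStronglyMeasurable (fun p : ℝ × Ω => h p.1 * U p.1 p.2)
      ((volume.restrict (Set.Ioc 0 t)).prod P) :=
  (hh.measurable.comp measurable_fst).aestronglyMeasurable.mul
    (aestronglyMeasurable_uncurry
      (fun s => (hU.memLp s).aestronglyMeasurable.aemeasurable) hU.cont _)

lemma integrable_prod (hU : IsWienerPath U P) {h : ℝ → ℝ} (hh : Continuous h) {Y : Ω → ℝ}
    (hY : MemLp Y 2 P) :
    Integrable (fun p : ℝ × Ω => h p.1 * U p.1 p.2 * Y p.2)
      ((volume.restrict (Set.Ioc 0 t)).prod P) := by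
  obtain ⟨D, hD⟩ := (isCompact_Icc (a := (0 : ℝ)) (b := t)).exists_bound_of_continuousOn
    hh.continuousOn
  refine integrable_prod_of_bound (C := D * ((t + ∫ ω, Y ω ^ 2 ∂P) / 2))
    ((hU.aestronglyMeasurable_mul hh).mul hY.aestronglyMeasurable.comp_snd) (fun s _ => ?_)
    fun s hs => ?_
  · simp only [mul_assoc]
    exact ((hU.memLp s).integrable_mul hY).const_mul _
  · have hs' : s ∈ Set.Icc 0 t := ⟨hs.1.le, hs.2⟩
    have hD0 : 0 ≤ D := (norm_nonneg _).trans (hD s hs')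
    have i1 := (hU.memLp s).integrable_sq
    have i2 := hY.integrable_sq
    calc ∫ ω, ‖h s * U s ω * Y ω‖ ∂P ≤ ∫ ω, D * ((U s ω ^ 2 + Y ω ^ 2) / 2) ∂P := by
          refine integral_mono_of_nonneg (Filter.Eventually.of_forall fun ω => norm_nonneg _)
            (((i1.add i2).div_const 2).const_mul D) (Filter.Eventually.of_forall fun ω => ?_)
          change ‖h s * U s ω * Y ω‖ ≤ D * ((U s ω ^ 2 + Y ω ^ 2) / 2)
          rw [mul_assoc, norm_mul]
          refine mul_le_mul (hD s hs') ?_ (norm_nonneg _) hD0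
          rw [Real.norm_eq_abs, abs_le]
          constructor <;> nlinarith [sq_nonneg (U s ω + Y ω), sq_nonneg (U s ω - Y ω)]
      _ = D * ((s + ∫ ω, Y ω ^ 2 ∂P) / 2) := by
          rw [integral_const_mul, integral_div, integral_add i1 i2, hU.sq s hs.1.le]
      _ ≤ _ := by gcongr; exact hs.2

/-- Fubini's theorem for the time integral of the process against a square-integrable variable. -/
lemma integral_integral_mul (hU : IsWienerPath U P) {h : ℝ → ℝ} (hh : Continuous h) {Y : Ω → ℝ}
    (hY : MemLp Y 2 P) (ht : 0 ≤ t) :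
    ∫ ω, (∫ s in (0 : ℝ)..t, h s * U s ω) * Y ω ∂P =
      ∫ s in (0 : ℝ)..t, h s * ∫ ω, U s ω * Y ω ∂P := by
  have h1 := integral_integral_swap (f := fun s ω => h s * U s ω * Y ω)
    (hU.integrable_prod (t := t) hh hY)
  simp only [intervalIntegral.integral_of_le ht, ← integral_mul_const]
  rw [← h1]
  simp only [mul_assoc, integral_const_mul]

lemma memLp_integral (hU : IsWienerPath U P) {h : ℝ → ℝ} (hh : Continuous h) (ht : 0 ≤ t) :
    MemLp (fun ω => ∫ s in (0 : ℝ)..t, h s * U s ω) 2 P := by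
  have hmeas : AEStronglyMeasurable (fun ω => ∫ s in (0 : ℝ)..t, h s * U s ω) P := by
    simp only [intervalIntegral.integral_of_le ht]
    exact (hU.aestronglyMeasurable_mul (t := t) hh).prod_swap.integral_prod_right'
  refine (memLp_two_iff_integrable_sq hmeas).2 ?_
  obtain ⟨D, hD⟩ := (isCompact_Icc (a := (0 : ℝ)) (b := t)).exists_bound_of_continuousOn
    hh.continuousOn
  have hint : Integrable (fun p : ℝ × Ω => (h p.1 * U p.1 p.2) ^ 2)
      ((volume.restrict (Set.Ioc 0 t)).prod P) := by
    refine integrable_prod_of_bound (C := D ^ 2 * t)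
      ((hU.aestronglyMeasurable_mul (t := t) hh).pow 2) (fun s _ => ?_) fun s hs => ?_
    · simp only [mul_pow]
      exact (hU.memLp s).integrable_sq.const_mul _
    · have hs' : s ∈ Set.Icc 0 t := ⟨hs.1.le, hs.2⟩
      have hn : ∀ ω, ‖(h s * U s ω) ^ 2‖ = h s ^ 2 * U s ω ^ 2 := fun ω => by
        rw [Real.norm_of_nonneg (sq_nonneg _), mul_pow]
      simp only [hn, integral_const_mul]
      rw [hU.sq s hs.1.le]
      refine mul_le_mul ?_ hs.2 hs.1.le (by positivity)
      rw [← sq_abs]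
      exact pow_le_pow_left₀ (abs_nonneg _) (hD s hs') 2
  have hint2 : Integrable (fun ω => t * ∫ s in Set.Ioc 0 t, (h s * U s ω) ^ 2) P :=
    hint.integral_prod_right.const_mul t
  refine hint2.mono' (hmeas.pow 2) ?_
  filter_upwards [hU.cont] with ω hω
  -- Cauchy–Schwarz in time
  have hc : Continuous fun s => h s * U s ω := hh.mul hω
  rw [Real.norm_of_nonneg (sq_nonneg _), ← intervalIntegral.integral_of_le ht]
  set J := ∫ s in (0 : ℝ)..t, h s * U s ω with hJ
  set Q := ∫ s in (0 : ℝ)..t, (h s * U s ω) ^ 2 with hQ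
  have hnn : 0 ≤ ∫ s in (0 : ℝ)..t, (t * (h s * U s ω) - J) ^ 2 :=
    intervalIntegral.integral_nonneg ht fun s _ => sq_nonneg _
  have hexp : ∫ s in (0 : ℝ)..t, (t * (h s * U s ω) - J) ^ 2 = t * (t * Q - J ^ 2) := by
    have e : ∀ s, (t * (h s * U s ω) - J) ^ 2 =
        t ^ 2 * (h s * U s ω) ^ 2 - 2 * t * J * (h s * U s ω) + J ^ 2 := fun s => by ring
    simp only [e]
    rw [intervalIntegral.integral_add, intervalIntegral.integral_sub,
      intervalIntegral.integral_const_mul, intervalIntegral.integral_const_mul,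
      intervalIntegral.integral_const, ← hJ, ← hQ, smul_eq_mul]
    · ring
    all_goals exact Continuous.intervalIntegrable (by fun_prop) _ _
  rcases ht.eq_or_lt with h0 | h0
  · have : J = 0 := by rw [hJ, ← h0, intervalIntegral.integral_same]
    simp [this, ← h0]
  · rw [hexp] at hnn
    linarith [nonneg_of_mul_nonneg_right hnn h0]

end IsWienerPath

/-- The Wiener integral `∫₀ᵗ g dU` of a `C¹` function `g` with derivative `g'`, defined pathwise
through integration by parts (for `U 0 = 0`). -/
noncomputable def wienerInt (g g' : ℝ → ℝ) (t : ℝ) (U : ℝ → Ω → ℝ) (ω : Ω) : ℝ :=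
  g t * U t ω - ∫ s in (0 : ℝ)..t, g' s * U s ω

variable {g g' h h' : ℝ → ℝ}

lemma memLp_wienerInt (hU : IsWienerPath U P) (hg' : Continuous g') (ht : 0 ≤ t) :
    MemLp (wienerInt g g' t U) 2 P :=
  ((hU.memLp t).const_mul _).sub (hU.memLp_integral hg' ht)

lemma integral_wienerInt_mul (hU : IsWienerPath U P) (hg' : Continuous g') (ht : 0 ≤ t)
    {Y : Ω → ℝ} (hY : MemLp Y 2 P) :
    ∫ ω, wienerInt g g' t U ω * Y ω ∂P =
      g t * (∫ ω, U t ω * Y ω ∂P) - ∫ s in (0 : ℝ)..t, g' s * ∫ ω, U s ω * Y ω ∂P := by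
  rw [← hU.integral_integral_mul hg' hY ht, ← integral_const_mul, ← integral_sub]
  · refine integral_congr_ae (Filter.Eventually.of_forall fun ω => ?_)
    simp only [wienerInt]
    ring
  · exact ((hU.memLp t).integrable_mul hY).const_mul _
  · exact (hU.memLp_integral hg' ht).integrable_mul hY

lemma integral_wienerInt (hU : IsWienerPath U P) (hg' : Continuous g') (ht : 0 ≤ t) :
    ∫ ω, wienerInt g g' t U ω ∂P = 0 := by
  have := integral_wienerInt_mul (g := g) hU hg' ht (memLp_const (1 : ℝ))
  simpa [hU.mean] using this

/-- Integration by parts against the kernel `min`. -/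
lemma integral_deriv_mul_min (hg : ∀ s, HasDerivAt g (g' s) s) (hg' : Continuous g') {r : ℝ}
    (hr0 : 0 ≤ r) (hrt : r ≤ t) :
    ∫ s in (0 : ℝ)..t, g' s * min s r = r * g t - ∫ s in (0 : ℝ)..r, g s := by
  have hgc : Continuous g := continuous_iff_continuousAt.2 fun s => (hg s).continuousAt
  have hii : ∀ a b, IntervalIntegrable (fun s => g' s * min s r) volume a b := fun a b =>
    Continuous.intervalIntegrable (by fun_prop) _ _
  rw [← intervalIntegral.integral_add_adjacent_intervals (hii 0 r) (hii r t)]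
  have h1 : ∫ s in (0 : ℝ)..r, g' s * min s r = ∫ s in (0 : ℝ)..r, s * g' s := by
    refine intervalIntegral.integral_congr fun s hs => ?_
    rw [Set.uIcc_of_le hr0] at hs
    simp only [min_eq_left hs.2]
    ring
  have h2 : ∫ s in r..t, g' s * min s r = ∫ s in r..t, g' s * r := by
    refine intervalIntegral.integral_congr fun s hs => ?_
    rw [Set.uIcc_of_le hrt] at hs
    simp only [min_eq_right hs.1]
  rw [h1, h2, intervalIntegral.integral_mul_const,
    intervalIntegral.integral_eq_sub_of_hasDerivAt (fun s _ => hg s) (hg'.intervalIntegrable _ _),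
    intervalIntegral.integral_mul_deriv_eq_deriv_mul (fun s _ => hasDerivAt_id' s) (fun s _ => hg s)
      (continuous_const.intervalIntegrable _ _) (hg'.intervalIntegrable _ _)]
  simp
  ring

/-- Itô's isometry for two Wiener integrals; `κ` is `1` for the same Brownian motion and `0` for
independent ones. -/
theorem integral_wienerInt_mul_wienerInt (hU : IsWienerPath U P) (hV : IsWienerPath V P) {κ : ℝ}
    (hcov : ∀ s r, 0 ≤ s → 0 ≤ r → ∫ ω, U s ω * V r ω ∂P = κ * min s r)
    (hg : ∀ s, HasDerivAt g (g' s) s) (hg' : Continuous g')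
    (hh : ∀ s, HasDerivAt h (h' s) s) (hh' : Continuous h') (ht : 0 ≤ t) :
    ∫ ω, wienerInt g g' t U ω * wienerInt h h' t V ω ∂P = κ * ∫ s in (0 : ℝ)..t, g s * h s := by
  have hgc : Continuous g := continuous_iff_continuousAt.2 fun s => (hg s).continuousAt
  have hhc : Continuous h := continuous_iff_continuousAt.2 fun s => (hh s).continuousAt
  have hone : ∀ r ∈ Set.Icc 0 t, ∫ ω, V r ω * wienerInt g g' t U ω ∂P =
      κ * ∫ s in (0 : ℝ)..r, g s := by
    intro r hr
    simp only [mul_comm (V r _)]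
    rw [integral_wienerInt_mul hU hg' ht (hV.memLp r), hcov t r ht hr.1, min_eq_right hr.2]
    have e : ∫ s in (0 : ℝ)..t, g' s * ∫ ω, U s ω * V r ω ∂P =
        κ * ∫ s in (0 : ℝ)..t, g' s * min s r := by
      rw [← intervalIntegral.integral_const_mul]
      refine intervalIntegral.integral_congr fun s hs => ?_
      rw [Set.uIcc_of_le ht] at hs
      simp only [hcov s r hs.1 hr.1]
      ring
    rw [e, integral_deriv_mul_min hg hg' hr.1 hr.2]
    ring
  simp only [mul_comm (wienerInt g g' t U _)]
  rw [integral_wienerInt_mul hV hh' ht (memLp_wienerInt hU hg' ht), hone t ⟨ht, le_rfl⟩]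
  have e : ∫ r in (0 : ℝ)..t, h' r * ∫ ω, V r ω * wienerInt g g' t U ω ∂P =
      κ * ∫ r in (0 : ℝ)..t, (∫ s in (0 : ℝ)..r, g s) * h' r := by
    rw [← intervalIntegral.integral_const_mul]
    refine intervalIntegral.integral_congr fun r hr => ?_
    rw [Set.uIcc_of_le ht] at hr
    simp only [hone r hr]
    ring
  rw [e, intervalIntegral.integral_mul_deriv_eq_deriv_mul
    (fun r _ => intervalIntegral.integral_hasDerivAt_right (hgc.intervalIntegrable _ _)
      (hgc.stronglyMeasurableAtFilter _ _) hgc.continuousAt) (fun r _ => hh r)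
    (hgc.intervalIntegrable _ _) (hh'.intervalIntegrable _ _)]
  simp
  ring

end WienerIntegral

/-! ### The matrix exponential and the variation-of-constants formula -/

section Semigroup

variable {n : ℕ} (L B : Matrix (Fin n) (Fin n) ℝ) (t : ℝ)

/-- An entry of the kernel `exp ((t - s) L) B` as a function of `s`. -/
noncomputable def kernelEntry (i j : Fin n) (s : ℝ) : ℝ :=
  (NormedSpace.exp ((t - s) • L) * B) i j

open scoped Matrix.Norms.Operator in
lemma hasDerivAt_kernelEntry (i j : Fin n) (s : ℝ) :
    HasDerivAt (kernelEntry L B t i j) (-kernelEntry L (L * B) t i j s) s := by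
  have h1 : HasDerivAt (fun s : ℝ => t - s) (-1) s := by
    simpa using (hasDerivAt_id s).const_sub t
  have h2 := (hasDerivAt_exp_smul_const (𝕂 := ℝ) L (t - s)).scomp s h1
  have h3 := ((Matrix.entryLinearMap ℝ ℝ i j).comp
    (LinearMap.mulRight ℝ B)).toContinuousLinearMap.hasFDerivAt.comp_hasDerivAt s h2
  refine h3.congr_deriv ?_
  change ((-1 : ℝ) • (NormedSpace.exp ((t - s) • L) * L) * B) i j = _
  simp [kernelEntry, Matrix.mul_assoc]

lemma continuous_kernelEntry (i j : Fin n) : Continuous (kernelEntry L B t i j) :=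
  continuous_iff_continuousAt.2 fun s => (hasDerivAt_kernelEntry L B t i j s).continuousAt

lemma kernelEntry_self (i j : Fin n) : kernelEntry L B t i j t = B i j := by
  simp [kernelEntry]

lemma kernelEntry_zero_one (i j : Fin n) :
    kernelEntry L 1 t i j 0 = (NormedSpace.exp (t • L)) i j := by
  simp [kernelEntry]

lemma kernelEntry_eq_sum (i j : Fin n) (s : ℝ) :
    kernelEntry L B t i j s = ∑ k, kernelEntry L 1 t i k s * B k j := by
  simp only [kernelEntry, mul_one]
  rw [Matrix.mul_apply]

lemma op_apply (A : Matrix (Fin n) (Fin n) ℝ) (v : Vec n) (i : Fin n) :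
    op A v i = ∑ j, A i j * v j := by
  simp [op, Matrix.ofLp_toEuclideanCLM, Matrix.mulVec, dotProduct]

/-- Variation of constants for the pathwise equation `x = x₀ + ∫ L x + B w`: the difference
`y = x - B w` is differentiable, and `exp ((t - s) L) y s` has derivative
`exp ((t - s) L) L B w s`. -/
theorem variation_of_constants {x w : ℝ → Vec n} {x₀ : Vec n} (hx : Continuous x)
    (hw : Continuous w) (ht : 0 ≤ t)
    (heq : ∀ s, 0 ≤ s → x s = x₀ + (∫ r in (0 : ℝ)..s, op L (x r)) + op B (w s)) (i : Fin n) :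
    x t i = op (NormedSpace.exp (t • L)) x₀ i +
      ∑ j, (B i j * w t j + ∫ s in (0 : ℝ)..t, kernelEntry L (L * B) t i j s * w s j) := by
  set y : ℝ → Vec n := fun s => x₀ + ∫ r in (0 : ℝ)..s, op L (x r) with hy
  have hLx : Continuous fun r => op L (x r) := (op L).continuous.comp hx
  have hyd : ∀ s, HasDerivAt y (op L (x s)) s := fun s =>
    (intervalIntegral.integral_hasDerivAt_right (hLx.intervalIntegrable _ _)
      (hLx.stronglyMeasurableAtFilter _ _) hLx.continuousAt).const_add x₀
  have hyj : ∀ s j, HasDerivAt (fun s => y s j) (op L (x s) j) s := fun s j =>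
    (EuclideanSpace.proj (𝕜 := ℝ) j).hasFDerivAt.comp_hasDerivAt s (hyd s)
  have hxy : ∀ s, 0 ≤ s → ∀ j, x s j = y s j + op B (w s) j := fun s hs j => by
    rw [heq s hs]; rfl
  have hfd : ∀ s, HasDerivAt (fun s => ∑ j, kernelEntry L 1 t i j s * y s j)
      (∑ j, (-kernelEntry L (L * 1) t i j s * y s j + kernelEntry L 1 t i j s * op L (x s) j)) s :=
    fun s => HasDerivAt.fun_sum fun j _ => (hasDerivAt_kernelEntry L 1 t i j s).mul (hyj s j)
  have hyc : ∀ j, Continuous fun s => y s j := fun j =>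
    continuous_iff_continuousAt.2 fun s => (hyj s j).continuousAt
  have hLxj : ∀ j, Continuous fun s => op L (x s) j := fun j =>
    (EuclideanSpace.proj (𝕜 := ℝ) j).continuous.comp hLx
  have hwj : ∀ j, Continuous fun s => w s j := fun j =>
    (EuclideanSpace.proj (𝕜 := ℝ) j).continuous.comp hw
  have hint := intervalIntegral.integral_eq_sub_of_hasDerivAt (a := 0) (b := t)
    (fun s _ => hfd s) (Continuous.intervalIntegrable (by
      refine continuous_finsetSum _ fun j _ => ?_
      exact ((continuous_kernelEntry L (L * 1) t i j).neg.mul (hyc j)).add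
        ((continuous_kernelEntry L 1 t i j).mul (hLxj j))) _ _)
  have hderiv : ∀ s, 0 ≤ s → ∑ j, (-kernelEntry L (L * 1) t i j s * y s j +
      kernelEntry L 1 t i j s * op L (x s) j) =
      ∑ j, kernelEntry L (L * B) t i j s * w s j := by
    intro s hs
    have e1 : ∑ j, kernelEntry L 1 t i j s * op L (x s) j =
        ∑ j, kernelEntry L L t i j s * x s j := by
      simp only [op_apply, Finset.mul_sum, kernelEntry_eq_sum L L, Finset.sum_mul]
      rw [Finset.sum_comm]
      simp only [mul_assoc]
    have e2 : ∑ j, kernelEntry L L t i j s * op B (w s) j =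
        ∑ j, kernelEntry L (L * B) t i j s * w s j := by
      have : ∀ j, kernelEntry L (L * B) t i j s =
          ∑ k, kernelEntry L L t i k s * B k j := fun j => by
        simp only [kernelEntry, ← Matrix.mul_assoc]
        rw [Matrix.mul_apply]
      simp only [this, op_apply, Finset.mul_sum, Finset.sum_mul]
      rw [Finset.sum_comm]
      simp only [mul_assoc]
    rw [Finset.sum_add_distrib, e1, ← e2, ← Finset.sum_add_distrib]
    refine Finset.sum_congr rfl fun j _ => ?_
    rw [hxy s hs j, mul_one]
    ring
  have hint2 : ∫ s in (0 : ℝ)..t, ∑ j, (-kernelEntry L (L * 1) t i j s * y s j +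
      kernelEntry L 1 t i j s * op L (x s) j) =
      ∑ j, ∫ s in (0 : ℝ)..t, kernelEntry L (L * B) t i j s * w s j := by
    have hii : ∀ j, IntervalIntegrable (fun s => kernelEntry L (L * B) t i j s * w s j)
        volume 0 t := fun j =>
      ((continuous_kernelEntry L (L * B) t i j).mul (hwj j)).intervalIntegrable _ _
    rw [← intervalIntegral.integral_finsetSum fun j _ => hii j]
    refine intervalIntegral.integral_congr fun s hs => ?_
    rw [Set.uIcc_of_le ht] at hs
    exact hderiv s hs.1
  rw [hint2] at hint
  have h0 : ∑ j, kernelEntry L 1 t i j 0 * y 0 j = op (NormedSpace.exp (t • L)) x₀ i := by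
    rw [op_apply]
    refine Finset.sum_congr rfl fun j _ => ?_
    rw [kernelEntry_zero_one]
    simp [hy]
  have h1 : ∑ j, kernelEntry L 1 t i j t * y t j = y t i := by
    simp [kernelEntry_self, Matrix.one_apply]
  rw [h0, h1] at hint
  rw [Finset.sum_add_distrib, hint, hxy t ht i, op_apply B]
  ring

end Semigroup

/-! ### Second moments -/

section Moments

variable {n : ℕ} {Ω : Type*} [MeasurableSpace Ω] {P : Measure Ω}

/-- Pythagoras for finitely many uncorrelated square-integrable variables. -/
lemma integral_sq_sum_of_orthogonal {ι : Type*} [DecidableEq ι] (s : Finset ι) {ξ : ι → Ω → ℝ}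
    {v : ι → ℝ} (hξ : ∀ a ∈ s, MemLp (ξ a) 2 P)
    (hort : ∀ a ∈ s, ∀ b ∈ s, ∫ ω, ξ a ω * ξ b ω ∂P = if a = b then v a else 0) :
    ∫ ω, (∑ a ∈ s, ξ a ω) ^ 2 ∂P = ∑ a ∈ s, v a := by
  simp only [sq, Finset.sum_mul_sum]
  have hi : ∀ a ∈ s, ∀ b ∈ s, Integrable (fun ω => ξ a ω * ξ b ω) P := fun a ha b hb =>
    (hξ a ha).integrable_mul (hξ b hb)
  rw [integral_finsetSum _ fun a ha => integrable_finsetSum _ (hi a ha)]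
  refine Finset.sum_congr rfl fun a ha => ?_
  rw [integral_finsetSum _ (hi a ha),
    Finset.sum_congr rfl (hort a ha), Finset.sum_ite_eq, if_pos ha]

variable [IsProbabilityMeasure P]

lemma memLp_and_integral_norm_sq {X : Ω → Vec n} {c : Vec n} {Y : Fin n → Ω → ℝ}
    (hX : ∀ᵐ ω ∂P, ∀ i, X ω i = c i + Y i ω) (hY : ∀ i, MemLp (Y i) 2 P)
    (hm : ∀ i, ∫ ω, Y i ω ∂P = 0) :
    MemLp X 2 P ∧ ∫ ω, ‖X ω‖ ^ 2 ∂P = ‖c‖ ^ 2 + ∑ i, ∫ ω, Y i ω ^ 2 ∂P := by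
  constructor
  · refine MemLp.of_eval_piLp fun i => ?_
    refine ((memLp_const (c i)).add (hY i)).ae_eq ?_
    filter_upwards [hX] with ω hω using (hω i).symm
  · have e : ∫ ω, ‖X ω‖ ^ 2 ∂P = ∫ ω, ∑ i, (c i ^ 2 + 2 * c i * Y i ω + Y i ω ^ 2) ∂P := by
      refine integral_congr_ae ?_
      filter_upwards [hX] with ω hω
      rw [EuclideanSpace.real_norm_sq_eq]
      refine Finset.sum_congr rfl fun i _ => ?_
      rw [hω i]
      ring
    have i1 : ∀ i, Integrable (fun ω => 2 * c i * Y i ω) P := fun i =>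
      ((hY i).integrable one_le_two).const_mul _
    have i2 : ∀ i, Integrable (fun ω => Y i ω ^ 2) P := fun i => (hY i).integrable_sq
    have i3 : ∀ i, Integrable (fun ω => c i ^ 2 + 2 * c i * Y i ω) P := fun i =>
      (integrable_const _).add (i1 i)
    have i4 : ∀ i, Integrable (fun ω => c i ^ 2 + 2 * c i * Y i ω + Y i ω ^ 2) P := fun i =>
      (i3 i).add (i2 i)
    rw [e, integral_finsetSum _ fun i _ => i4 i, EuclideanSpace.real_norm_sq_eq,
      ← Finset.sum_add_distrib]
    refine Finset.sum_congr rfl fun i _ => ?_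
    rw [integral_add (i3 i) (i2 i), integral_add (integrable_const _) (i1 i), integral_const_mul,
      hm i]
    simp

lemma isWienerPath_of_isBrownianReal {W : ℝ≥0 → Ω → ℝ} (hW : IsBrownianReal W P) :
    IsWienerPath (fun s ω => W s.toNNReal ω) P where
  cont := by
    filter_upwards [hW.cont] with ω hω
    exact hω.comp continuous_real_toNNReal
  memLp s := (hW.toIsPreBrownianReal.hasLaw_eval _).hasGaussianLaw.memLp_two
  mean s := hW.toIsPreBrownianReal.integral_eval _
  sq s hs := by
    have hm := (hW.toIsPreBrownianReal.hasLaw_eval s.toNNReal).hasGaussianLaw.memLp_two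
    have h := hW.toIsPreBrownianReal.covariance_eval s.toNNReal s.toNNReal
    rw [covariance_eq_sub hm hm, hW.toIsPreBrownianReal.integral_eval, mul_zero, sub_zero,
      min_self, Real.coe_toNNReal s hs] at h
    refine Eq.trans ?_ h
    exact integral_congr_ae (Filter.Eventually.of_forall fun ω => by simp [_root_.sq])

lemma IsWiener.integral_mul {W : ℝ≥0 → Ω → Vec n} (hW : IsWiener W P) (i j : Fin n) (s r : ℝ)
    (hs : 0 ≤ s) (hr : 0 ≤ r) :
    ∫ ω, W s.toNNReal ω i * W r.toNNReal ω j ∂P = (if i = j then 1 else 0) * min s r := by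
  have hm : ∀ k u, MemLp (fun ω => W u ω k) 2 P := fun k u =>
    ((hW.brownian k).toIsPreBrownianReal.hasLaw_eval u).hasGaussianLaw.memLp_two
  have h0 : ∫ ω, W s.toNNReal ω i ∂P = 0 := (hW.brownian i).toIsPreBrownianReal.integral_eval _
  have hcov := covariance_eq_sub (hm i s.toNNReal) (hm j r.toNNReal)
  rw [h0, zero_mul, sub_zero] at hcov
  refine Eq.trans hcov.symm ?_
  split_ifs with hij
  · subst hij
    rw [(hW.brownian i).toIsPreBrownianReal.covariance_fun_eval]
    simp [hs, hr]
  · have hind := (hW.indep.indepFun hij).comp (measurable_pi_apply s.toNNReal)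
      (measurable_pi_apply r.toNNReal)
    rw [zero_mul]
    exact hind.covariance_eq_zero (hm i _) (hm j _)

/-- The second moment of the solution, by variation of constants and Itô's isometry. -/
theorem memLp_and_integral_norm_sq_solution (L B : Matrix (Fin n) (Fin n) ℝ) (x₀ : Vec n)
    {W X : ℝ≥0 → Ω → Vec n} (hW : IsWiener W P) (hX : IsSDESolution L B x₀ W X P) (t : ℝ≥0) :
    MemLp (X t) 2 P ∧ ∫ ω, ‖X t ω‖ ^ 2 ∂P = ‖op (NormedSpace.exp ((t : ℝ) • L)) x₀‖ ^ 2 +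
      ∑ i, ∑ j, ∫ s in (0 : ℝ)..t, kernelEntry L B t i j s ^ 2 := by
  have ht : (0 : ℝ) ≤ t := t.coe_nonneg
  have hU : ∀ j, IsWienerPath (fun s ω => W s.toNNReal ω j) P := fun j =>
    isWienerPath_of_isBrownianReal (hW.brownian j)
  set I : Fin n → Fin n → Ω → ℝ := fun i j => wienerInt (kernelEntry L B t i j)
    (fun s => -kernelEntry L (L * B) t i j s) t (fun s ω => W s.toNNReal ω j) with hI
  have hcont : ∀ i j, Continuous fun s => -kernelEntry L (L * B) t i j s := fun i j =>
    (continuous_kernelEntry L (L * B) t i j).neg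
  have hIm : ∀ i j, MemLp (I i j) 2 P := fun i j => memLp_wienerInt (hU j) (hcont i j) ht
  have hrep : ∀ᵐ ω ∂P, ∀ i, X t ω i =
      op (NormedSpace.exp ((t : ℝ) • L)) x₀ i + ∑ j, I i j ω := by
    filter_upwards [hX.continuous_paths, hX.integral_eq,
      ae_all_iff.2 fun j => (hW.brownian j).cont] with ω h1 h2 h3 i
    have hWc : Continuous fun s => W s ω := (PiLp.continuous_toLp 2 _).comp (continuous_pi h3)
    have := variation_of_constants L B t (x := fun s => X s.toNNReal ω)
      (w := fun s => W s.toNNReal ω) (x₀ := x₀) (h1.comp continuous_real_toNNReal)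
      (hWc.comp continuous_real_toNNReal) ht (fun s hs => by
        have := h2 s.toNNReal
        rwa [Real.coe_toNNReal s hs] at this) i
    simp only [Real.toNNReal_coe] at this
    rw [this]
    congr 1
    refine Finset.sum_congr rfl fun j _ => ?_
    simp [hI, wienerInt, kernelEntry_self]
  obtain ⟨h1, h2⟩ := memLp_and_integral_norm_sq hrep
    (fun i => memLp_finsetSum _ fun j _ => hIm i j) (fun i => by
      rw [integral_finsetSum _ fun j _ => (hIm i j).integrable one_le_two]
      exact Finset.sum_eq_zero fun j _ => integral_wienerInt (hU j) (hcont i j) ht)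
  refine ⟨h1, h2.trans ?_⟩
  congr 1
  refine Finset.sum_congr rfl fun i _ => ?_
  refine integral_sq_sum_of_orthogonal Finset.univ (fun j _ => hIm i j) fun j _ k _ => ?_
  rw [integral_wienerInt_mul_wienerInt (hU j) (hU k)
    (fun s r hs hr => hW.integral_mul j k s r hs hr) (hasDerivAt_kernelEntry L B t i j) (hcont i j)
    (hasDerivAt_kernelEntry L B t i k) (hcont i k) ht]
  split_ifs with hjk
  · subst hjk
    simp [sq]
  · simp

/-- The second moment of the truncated expansion. -/
theorem memLp_and_integral_norm_sq_klApprox (L B : Matrix (Fin n) (Fin n) ℝ) (x₀ : Vec n)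
    {Z : ℕ → Ω → Vec n} (hZ : IsStdNormalSeq Z P) (m : ℕ) (t : ℝ) :
    MemLp (klApprox L B x₀ Z m t) 2 P ∧
      ∫ ω, ‖klApprox L B x₀ Z m t ω‖ ^ 2 ∂P = ‖op (NormedSpace.exp (t • L)) x₀‖ ^ 2 +
      ∑ i, ∑ k ∈ Finset.range m, ∑ j, 2 * (phiCos (k + 1) t L * B) i j ^ 2 := by
  have hZm : ∀ k j, MemLp (fun ω => Z (k + 1) ω j) 2 P := fun k j =>
    (hZ.law k j).hasGaussianLaw.memLp_two
  have hZ0 : ∀ k j, ∫ ω, Z (k + 1) ω j ∂P = 0 := fun k j => by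
    rw [(hZ.law k j).integral_eq, integral_id_gaussianReal]
  have hZZ : ∀ p q : ℕ × Fin n, ∫ ω, Z (p.1 + 1) ω p.2 * Z (q.1 + 1) ω q.2 ∂P =
      if p = q then 1 else 0 := by
    intro p q
    have hcov := covariance_eq_sub (hZm p.1 p.2) (hZm q.1 q.2)
    rw [hZ0, zero_mul, sub_zero] at hcov
    refine Eq.trans hcov.symm ?_
    split_ifs with hpq
    · subst hpq
      rw [covariance_self (hZm p.1 p.2).aestronglyMeasurable.aemeasurable,
        (hZ.law p.1 p.2).variance_eq, variance_id_gaussianReal]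
      simp
    · exact (hZ.indep.indepFun hpq).covariance_eq_zero (hZm p.1 p.2) (hZm q.1 q.2)
  set ξ : Fin n → ℕ × Fin n → Ω → ℝ := fun i p ω =>
    √2 * (phiCos (p.1 + 1) t L * B) i p.2 * Z (p.1 + 1) ω p.2 with hξ
  have hξm : ∀ i p, MemLp (ξ i p) 2 P := fun i p => (hZm p.1 p.2).const_mul _
  have hrep : ∀ ω i, klApprox L B x₀ Z m t ω i = op (NormedSpace.exp (t • L)) x₀ i +
      ∑ p ∈ Finset.range m ×ˢ Finset.univ, ξ i p ω := by
    intro ω i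
    have hshift : ∀ f : ℕ → Vec n, ∑ k ∈ Finset.Icc 1 m, f k = ∑ k ∈ Finset.range m, f (k + 1) := by
      intro f
      rw [Finset.range_eq_Ico, Finset.sum_Ico_add' f 0 m 1]
      rfl
    rw [klApprox, hshift, Finset.sum_product]
    simp only [PiLp.add_apply, PiLp.smul_apply, WithLp.ofLp_sum, Finset.sum_apply, op_apply,
      smul_eq_mul, Finset.mul_sum, hξ, mul_assoc]
  obtain ⟨h1, h2⟩ := memLp_and_integral_norm_sq (P := P)
    (Filter.Eventually.of_forall hrep)
    (fun i => memLp_finsetSum _ fun p _ => hξm i p) (fun i => by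
      rw [integral_finsetSum _ fun p _ => (hξm i p).integrable one_le_two]
      refine Finset.sum_eq_zero fun p _ => ?_
      simp only [hξ]
      rw [integral_const_mul, hZ0, mul_zero])
  refine ⟨h1, h2.trans ?_⟩
  congr 1
  refine Finset.sum_congr rfl fun i _ => ?_
  rw [← Finset.sum_product' (Finset.range m) Finset.univ
    (fun k j => 2 * (phiCos (k + 1) t L * B) i j ^ 2)]
  refine integral_sq_sum_of_orthogonal _ (fun p _ => hξm i p) fun p _ q _ => ?_
  have e : ∀ ω, ξ i p ω * ξ i q ω = (√2 * (phiCos (p.1 + 1) t L * B) i p.2) *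
      (√2 * (phiCos (q.1 + 1) t L * B) i q.2) * (Z (p.1 + 1) ω p.2 * Z (q.1 + 1) ω q.2) :=
    fun ω => by simp only [hξ]; ring
  simp only [e]
  rw [integral_const_mul, hZZ]
  split_ifs with hpq
  · subst hpq
    rw [mul_one, ← sq, mul_pow, Real.sq_sqrt (by norm_num)]
  · simp

end Moments

/-! ### The Frobenius norms of the coefficients -/

section Frobenius

variable {n : ℕ}

lemma frobeniusNorm_sq (A : Matrix (Fin n) (Fin n) ℝ) :
    frobeniusNorm A ^ 2 = ∑ i, ∑ j, A i j ^ 2 := by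
  rw [frobeniusNorm, Matrix.frobenius_norm_def, ← Real.sqrt_eq_rpow, Real.sq_sqrt]
  · simp
  · positivity

lemma frobeniusNorm_sq_eq_trace (A : Matrix (Fin n) (Fin n) ℝ) :
    frobeniusNorm A ^ 2 = (A.transpose * A).trace := by
  rw [frobeniusNorm_sq, Finset.sum_comm]
  simp [Matrix.trace, Matrix.mul_apply, sq]

lemma phiCos_mul_apply (L B : Matrix (Fin n) (Fin n) ℝ) (k : ℕ) (t : ℝ) (i j : Fin n) :
    (phiCos k t L * B) i j =
      ∫ s in (0 : ℝ)..t, kernelEntry L B t i j s * Real.cos (freq k * s) := by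
  rw [Matrix.mul_apply]
  have hi : ∀ l, IntervalIntegrable
      (fun s => kernelEntry L 1 t i l s * Real.cos (freq k * s) * B l j) volume 0 t := fun l =>
    (((continuous_kernelEntry L 1 t i l).mul (by fun_prop)).mul
      continuous_const).intervalIntegrable _ _
  have e : ∀ s, kernelEntry L B t i j s * Real.cos (freq k * s) =
      ∑ l, kernelEntry L 1 t i l s * Real.cos (freq k * s) * B l j := fun s => by
    rw [kernelEntry_eq_sum, Finset.sum_mul]
    exact Finset.sum_congr rfl fun l _ => by ring
  simp only [e]
  rw [intervalIntegral.integral_finsetSum fun l _ => hi l]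
  refine Finset.sum_congr rfl fun l _ => ?_
  rw [intervalIntegral.integral_mul_const]
  simp [phiCos, kernelEntry]

/-- Parseval's identity for every entry of the kernel. -/
lemma hasSum_frobeniusNorm_sq (L B : Matrix (Fin n) (Fin n) ℝ) {t : ℝ} (ht0 : 0 ≤ t)
    (ht : t ≤ 1) :
    HasSum (fun k => 2 * frobeniusNorm (phiCos (k + 1) t L * B) ^ 2)
      (∑ i, ∑ j, ∫ s in (0 : ℝ)..t, kernelEntry L B t i j s ^ 2) := by
  simp only [frobeniusNorm_sq, Finset.mul_sum, phiCos_mul_apply]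
  refine hasSum_sum fun i _ => hasSum_sum fun j _ => ?_
  have h := (hasSum_sq_integral_mul_cos (continuous_kernelEntry L B t i j) ht0 ht).mul_left 2
  rwa [← mul_assoc, mul_one_div_cancel two_ne_zero, one_mul] at h

lemma exists_orthogonal_diagonalization {L : Matrix (Fin n) (Fin n) ℝ}
    (hL : (-L).PosSemidef) : ∃ (U : Matrix (Fin n) (Fin n) ℝ) (a : Fin n → ℝ),
      U.transpose * U = 1 ∧ U * U.transpose = 1 ∧ (∀ i, 0 ≤ a i) ∧
      L = U * Matrix.diagonal (-a) * U.transpose := by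
  have hstar : star (hL.1.eigenvectorUnitary : Matrix (Fin n) (Fin n) ℝ) =
      (hL.1.eigenvectorUnitary : Matrix (Fin n) (Fin n) ℝ).transpose := by
    ext i j; simp [Matrix.star_apply]
  refine ⟨hL.1.eigenvectorUnitary, hL.1.eigenvalues, ?_, ?_, hL.eigenvalues_nonneg, ?_⟩
  · rw [← hstar]; exact Unitary.coe_star_mul_self _
  · rw [← hstar]; exact Unitary.coe_mul_star_self _
  · have h := hL.1.spectral_theorem
    rw [Unitary.conjStarAlgAut_apply, hstar] at h
    have hd : Matrix.diagonal (-hL.1.eigenvalues) =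
        -Matrix.diagonal (RCLike.ofReal ∘ hL.1.eigenvalues : Fin n → ℝ) := by
      ext i j
      by_cases hij : i = j <;> simp [hij]
    rw [hd, mul_neg, neg_mul, ← h, neg_neg]

lemma kernelEntry_diagonalization (B : Matrix (Fin n) (Fin n) ℝ)
    {U : Matrix (Fin n) (Fin n) ℝ} (a : Fin n → ℝ) (hU : U * U.transpose = 1) (t s : ℝ)
    (i j : Fin n) :
    kernelEntry (U * Matrix.diagonal (-a) * U.transpose) B t i j s =
      ∑ l, U i l * (Real.exp (-(a l * (t - s))) * (U.transpose * B) l j) := by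
  have hinv : U⁻¹ = U.transpose := Matrix.inv_eq_right_inv hU
  have hexp : NormedSpace.exp ((t - s) • (U * Matrix.diagonal (-a) * U.transpose)) =
      U * Matrix.diagonal (fun l => Real.exp (-(a l * (t - s)))) * U.transpose := by
    have h := Matrix.exp_conj U (Matrix.diagonal ((t - s) • (-a))) (IsUnit.of_mul_eq_one _ hU)
    rw [hinv, Matrix.exp_diagonal] at h
    rw [← Matrix.smul_mul, ← Matrix.mul_smul, ← Matrix.diagonal_smul, h]
    congr 3
    funext l
    rw [Pi.coe_exp, ← Real.exp_eq_exp_ℝ]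
    simp [mul_comm]
  rw [kernelEntry, hexp, Matrix.mul_assoc, Matrix.mul_assoc, Matrix.mul_apply]
  simp only [Matrix.diagonal_mul]

/-- In an orthonormal eigenbasis of `L` the coefficients decouple into the scalar ones. -/
lemma frobeniusNorm_sq_diagonalization (B : Matrix (Fin n) (Fin n) ℝ)
    {U : Matrix (Fin n) (Fin n) ℝ} (a : Fin n → ℝ) (hU : U * U.transpose = 1)
    (hU' : U.transpose * U = 1) {k : ℕ} (hk : 1 ≤ k) (t : ℝ) :
    frobeniusNorm (phiCos k t (U * Matrix.diagonal (-a) * U.transpose) * B) ^ 2 =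
      ∑ i, expCos (a i) (freq k) t ^ 2 * ∑ j, (U.transpose * B) i j ^ 2 := by
  have hphi : phiCos k t (U * Matrix.diagonal (-a) * U.transpose) * B =
      U * (Matrix.diagonal (fun l => expCos (a l) (freq k) t) * (U.transpose * B)) := by
    ext i j
    rw [phiCos_mul_apply, Matrix.mul_apply]
    simp only [kernelEntry_diagonalization B a hU, Finset.sum_mul, Matrix.diagonal_mul]
    rw [intervalIntegral.integral_finsetSum fun l _ =>
      Continuous.intervalIntegrable (by fun_prop) _ _]
    refine Finset.sum_congr rfl fun l _ => ?_
    rw [← integral_exp_mul_cos (a l) (freq_pos hk) t, ← intervalIntegral.integral_mul_const,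
      ← intervalIntegral.integral_const_mul]
    refine intervalIntegral.integral_congr fun s _ => ?_
    ring
  rw [hphi, frobeniusNorm_sq_eq_trace, Matrix.transpose_mul, Matrix.mul_assoc,
    ← Matrix.mul_assoc U.transpose, hU', Matrix.one_mul, ← frobeniusNorm_sq_eq_trace,
    frobeniusNorm_sq]
  simp only [Matrix.diagonal_mul, mul_pow, Finset.mul_sum]

lemma sum_sq_row_le (B : Matrix (Fin n) (Fin n) ℝ) {U : Matrix (Fin n) (Fin n) ℝ}
    (hU' : U.transpose * U = 1) (i : Fin n) :
    ∑ j, (U.transpose * B) i j ^ 2 ≤ ‖op B‖ ^ 2 := by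
  set u : Vec n := WithLp.toLp 2 fun a => U a i with hu
  have hun : ‖u‖ = 1 := by
    have h := congrFun (congrFun hU' i) i
    rw [Matrix.mul_apply, Matrix.one_apply_eq] at h
    rw [← sq_eq_sq₀ (norm_nonneg _) zero_le_one, EuclideanSpace.real_norm_sq_eq, one_pow, ← h]
    exact Finset.sum_congr rfl fun a _ => by simp [hu, sq]
  have hB : ‖op B.transpose‖ = ‖op B‖ := by
    have : B.transpose = star B := by ext a b; simp [Matrix.star_apply]
    rw [op, this, map_star, ContinuousLinearMap.star_eq_adjoint]
    exact ContinuousLinearMap.adjoint.norm_map _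
  have hle := (op B.transpose).le_opNorm u
  rw [hun, mul_one, hB] at hle
  refine le_trans (le_of_eq ?_) (pow_le_pow_left₀ (norm_nonneg _) hle 2)
  rw [EuclideanSpace.real_norm_sq_eq]
  refine Finset.sum_congr rfl fun j _ => ?_
  rw [op_apply, Matrix.mul_apply]
  congr 1
  exact Finset.sum_congr rfl fun a _ => by simp [hu, mul_comm]

/-- The tail bound for symmetric negative semidefinite `L`. -/
lemma sum_frobeniusNorm_sq_le {L : Matrix (Fin n) (Fin n) ℝ} (hL : (-L).PosSemidef)
    (B : Matrix (Fin n) (Fin n) ℝ) {t : ℝ} (ht0 : 0 ≤ t) {m : ℕ} (hm : 2 ≤ m) (N : ℕ) :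
    ∑ j ∈ Finset.range N, frobeniusNorm (phiCos (m + 1 + j) t L * B) ^ 2 ≤
      n * (1 / (Real.pi ^ 2 * ((m : ℝ) - 1)) * ‖op B‖ ^ 2) := by
  obtain ⟨U, a, hU', hU, ha, rfl⟩ := exists_orthogonal_diagonalization hL
  have hm1 : (0 : ℝ) ≤ (m : ℝ) - 1 := by
    have : (2 : ℝ) ≤ m := by exact_mod_cast hm
    linarith
  have e : ∀ j, frobeniusNorm (phiCos (m + 1 + j) t
      (U * Matrix.diagonal (-a) * U.transpose) * B) ^ 2 = _ := fun j =>
    frobeniusNorm_sq_diagonalization B a hU hU' (by omega) t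
  simp only [e]
  rw [Finset.sum_comm]
  simp only [← Finset.sum_mul]
  have h : ∀ i ∈ (Finset.univ : Finset (Fin n)),
      (∑ j ∈ Finset.range N, expCos (a i) (freq (m + 1 + j)) t ^ 2) *
        ∑ j, (U.transpose * B) i j ^ 2 ≤ 1 / (Real.pi ^ 2 * ((m : ℝ) - 1)) * ‖op B‖ ^ 2 :=
    fun i _ => mul_le_mul (sum_sq_expCos_freq_le (ha i) ht0 N hm) (sum_sq_row_le B hU' i)
      (by positivity) (by positivity)
  refine (Finset.sum_le_sum h).trans (le_of_eq ?_)
  simp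

end Frobenius

end KLSampling

theorem theorem8 {n : ℕ} {Ω : Type*} [MeasurableSpace Ω] (P : Measure Ω) [IsProbabilityMeasure P]
    (L B : Matrix (Fin n) (Fin n) ℝ) (x₀ : KLSampling.Vec n)
    (W X : ℝ≥0 → Ω → KLSampling.Vec n) (Z : ℕ → Ω → KLSampling.Vec n)
    (hW : KLSampling.IsWiener W P)
    (hX : KLSampling.IsSDESolution L B x₀ W X P)
    (hZ : KLSampling.IsStdNormalSeq Z P)
    (t : ℝ≥0) (ht : t ≤ 1) (m : ℕ) :
    (MemLp (X t) 2 P ∧ MemLp (KLSampling.klApprox L B x₀ Z m t) 2 P ∧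
      Summable (fun j : ℕ =>
        KLSampling.frobeniusNorm (KLSampling.phiCos (m + 1 + j) t L * B) ^ 2) ∧
      (∫ ω, ‖X t ω‖ ^ 2 ∂P) - (∫ ω, ‖KLSampling.klApprox L B x₀ Z m t ω‖ ^ 2 ∂P) =
        2 * ∑' j : ℕ,
          KLSampling.frobeniusNorm (KLSampling.phiCos (m + 1 + j) t L * B) ^ 2) ∧
    ((-L).PosSemidef → 2 ≤ m →
      (∫ ω, ‖X t ω‖ ^ 2 ∂P) - (∫ ω, ‖KLSampling.klApprox L B x₀ Z m t ω‖ ^ 2 ∂P) ≤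
        2 * ‖KLSampling.op B‖ ^ 2 / Real.pi ^ 2 * ((n : ℝ) / ((m : ℝ) - 1))) := by
  have ht0 : (0 : ℝ) ≤ t := t.coe_nonneg
  have ht1 : (t : ℝ) ≤ 1 := by exact_mod_cast ht
  obtain ⟨hX2, hXint⟩ := KLSampling.memLp_and_integral_norm_sq_solution L B x₀ hW hX t
  obtain ⟨hK2, hKint⟩ := KLSampling.memLp_and_integral_norm_sq_klApprox L B x₀ hZ m (t : ℝ)
  have hsum := KLSampling.hasSum_frobeniusNorm_sq L B ht0 ht1
  have htail : HasSum
      (fun j => 2 * KLSampling.frobeniusNorm (KLSampling.phiCos (m + 1 + j) t L * B) ^ 2)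
      ((∫ ω, ‖X t ω‖ ^ 2 ∂P) - (∫ ω, ‖KLSampling.klApprox L B x₀ Z m t ω‖ ^ 2 ∂P)) := by
    have h := (hasSum_nat_add_iff' m).2 hsum
    have e : ∀ j, m + 1 + j = j + m + 1 := fun j => by omega
    simp only [e]
    have e2 : ∑ i, ∑ k ∈ Finset.range m, ∑ j, 2 * (KLSampling.phiCos (k + 1) t L * B) i j ^ 2 =
        ∑ k ∈ Finset.range m,
          2 * KLSampling.frobeniusNorm (KLSampling.phiCos (k + 1) t L * B) ^ 2 := by
      simp only [KLSampling.frobeniusNorm_sq, Finset.mul_sum]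
      rw [Finset.sum_comm]
    rw [hXint, hKint, add_sub_add_left_eq_sub, e2]
    exact h
  have hS : Summable (fun j : ℕ =>
      KLSampling.frobeniusNorm (KLSampling.phiCos (m + 1 + j) t L * B) ^ 2) :=
    (summable_mul_left_iff two_ne_zero).1 htail.summable
  have heq : (∫ ω, ‖X t ω‖ ^ 2 ∂P) - (∫ ω, ‖KLSampling.klApprox L B x₀ Z m t ω‖ ^ 2 ∂P) =
      2 * ∑' j : ℕ, KLSampling.frobeniusNorm (KLSampling.phiCos (m + 1 + j) t L * B) ^ 2 := by
    rw [← tsum_mul_left, htail.tsum_eq]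
  refine ⟨⟨hX2, hK2, hS, heq⟩, fun hL hm => ?_⟩
  rw [heq]
  have hle := hS.tsum_le_of_sum_range_le fun N =>
    KLSampling.sum_frobeniusNorm_sq_le hL B ht0 hm N
  refine (mul_le_mul_of_nonneg_left hle zero_le_two).trans (le_of_eq ?_)
  have hm1 : (m : ℝ) - 1 ≠ 0 := by
    have : (2 : ℝ) ≤ m := by exact_mod_cast hm
    linarith
  field_simp
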